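/- **Setting.** An *arrow presentation* $\mathbb G$ is a finite set of circles (the *vertices*, $V(\mathbb G)$) with finitely many directed arcs (*arrows*) lying disjointly on them, each labelled by an *edge* so that every edge labels exactly two arrows. Write $\overrightarrow{p_1p_2}$ for the arrow directed from $p_1$ to $p_2$. The *boundary components* $B(\mathbb G)$ are the closed curves obtained by replacing, for every edge with arrows $\overrightarrow{p_1p_2}$, $\overrightarrow{q_1q_2}$, the two arrows by a curve joining $p_1$ to $q_2$ and a curve joining $p_2$ to $q_1$. A *packaged arrow presentation* is a triple $G=(\mathbb G,\mathcal V,\mathcal B)$ with $\mathcal V$ a partition of $V(\mathbb G)$ and $\mathcal B$ a partition of $B(\mathbb G)$. Let $e$ be an edge of $G$ with arrows $\overrightarrow{p_1p_2},\overrightarrow{q_1q_2}$. On arrow presentations: *deletion* $\mathbb G\backslash e$ removes the two arrows but keeps the arcs under them; *contraction* $\mathbb G/e$ removes the two arrows with their arcs and identifies $p_1$ with $q_2$ and $p_2$ with $q_1$; *Penrose-contraction* $\mathbb G\times e$ removes them with their arcs and identifies $p_1$ with $q_1$ and $p_2$ with $q_2$. To *unite the vertex classes at $e$* means to replace the classes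 of the vertices incident with $e$ by a single class, which also receives the vertices created by the operation in place of those destroyed; *uniting the boundary classes at $e$* is defined in the same way. The five operations on $G$ are: *delete* $G\backslash e$ (delete; unite the boundary classes, keep $\mathcal V$); *contract* $G/e$ (contract; unite the vertex classes, keep $\mathcal B$); *Penrose-contract* $G\times e$ (Penrose-contract; unite both); *merge-delete* $G\backslash_{m} e$ (delete; unite both); *merge-contract* $G/_{m}e$ (contract; unite both). Let $R=\mathbb Z[a,b,c,x,y,\alpha,\beta,\gamma]$, and let $Q$ be the unique map from packaged arrow presentations to $R$ such that $$Q(G)=a\,Q(G\backslash e)+b\,Q(G/e)+c\,Q(G\times e)+x\,Q(G\backslash_m e)+y\,Q(G/_m e)$$ for every edge $e$ of $G$, and $Q(G)=\alpha^{|V(\mathbb G)|}\beta^{|\mathcal V|}\gamma^{|\mathcal B|}$ if $G$ has no edges. Let $f$ be an edge of $G$, $e$ an edge of another packaged arrow presentation $H$, disjoint from $G$, and let $\varphi$ be a *coupling*, i.e. a bijection from the two arrows of $f$ to the two arrows of $e$; say $\varphi$ sends $\overrightarrow{p_1p_2}$ to $\overrightarrow{q_1q_2}$ and $\overrightarrow{p_3p_4}$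 to $\overrightarrow{q_3q_4}$. The *2-sum* $G\oplus_\varphi H$ is obtained from the disjoint union by removing these four arrows with the arcs under them and identifying $p_i$ with $q_i$ for $i=1,\dots,4$. Its vertex partition is obtained from the union of the two vertex partitions by uniting the class of the vertex through $p_1,p_2$ with that of the vertex through $q_1,q_2$, and the class of the vertex through $p_3,p_4$ with that of the vertex through $q_3,q_4$; its boundary partition is obtained from the union of the two boundary partitions by uniting the class of the boundary component through $p_1,p_4$ with that of the one through $q_1,q_4$, and the class of the one through $p_2,p_3$ with that of the one through $q_2,q_3$. (Classes that thereby come to overlap are united; new vertices and boundary components take the place of the ones they are made from.) **Statement.** The linear system $$\alpha\beta\gamma\begin{bmatrix}\alpha\beta&1&1&\alpha&1\\1&\alpha\gamma&1&1&\alpha\\1&1&\alpha&1&1\\\alpha&1&1&\alpha&1\\1&\alpha&1&1&\alpha\end{bmatrix}\begin{bmatrix}\phi_{(=,2)}\\\phi_{(\parallel,2)}\\\phi_\times\\\phi_{(=,1)}\\\phi_{(\parallel,1)}\end{bmatrix}=\begin{bmatrix}Q(H\backslash e)\\Q(H/e)\\Q(H\times e)\\Q(H\backslash_m e)\\Q(H/_m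 e)\end{bmatrix}$$ has exactly one solution over the field of fractions of $R$, this solution has its entries in $R$, and with it $$Q(G\oplus_\varphi H)=\phi_{(=,2)}\,Q(G\backslash f)+\phi_{(\parallel,2)}\,Q(G/f)+\phi_\times\,Q(G\times f)+\phi_{(=,1)}\,Q(G\backslash_m f)+\phi_{(\parallel,1)}\,Q(G/_m f).$$ -/

import Mathlib

open scoped Matrix

/-- An arrow presentation, described by finitely many points on its circles.

The points cut the circles into arcs that are alternately of two kinds, *gap arcs* and *segments*:
each point is an end of exactly one gap arc, the other end of which is `gap x`, and of exactly one
segment, the other end of which is `seg x`. Every circle carries at least two points. The arrows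
lie on segments; a segment that carries no arrow is just a piece of its circle, so that a circle
without arrows is presented, for instance, by two points, one gap arc and one segment.

The edge set is `edges`. The edge `e` is constituted by two arrows, numbered by `i : Bool`; the
`i`-th one is the directed segment from its tail `pt e i false` to its head `pt e i true`.
(The values of `pt` at labels outside `edges` have no meaning.) -/
@[ext] structure ArrowPresentation (X : Type*) (E : Type*) where
  gap : Equiv.Perm X
  seg : Equiv.Perm X
  gap_gap : ∀ x, gap (gap x) = x
  gap_ne : ∀ x, gap x ≠ x
  seg_seg : ∀ x, seg (seg x) = x
  seg_ne : ∀ x, seg x ≠ x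
  edges : Finset E
  pt : E → Bool → Bool → X
  pt_inj : ∀ e ∈ edges, ∀ e' ∈ edges, ∀ i s j t, pt e i s = pt e' j t → e = e' ∧ i = j ∧ s = t
  seg_pt : ∀ e ∈ edges, ∀ i, seg (pt e i false) = pt e i true

/-- The equivalence relation obtained from `r` by uniting the class of `x` and the class of `y`. -/
def Setoid.mergeClasses {X : Type*} (r : Setoid X) (x y : X) : Setoid X :=
  r ⊔ Relation.EqvGen.setoid (fun s t => s = x ∧ t = y)

/-- The disjoint union of two equivalence relations. -/
def Setoid.disjUnion {X Y : Type*} (r : Setoid X) (s : Setoid Y) : Setoid (X ⊕ Y) where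
  r := Sum.LiftRel r.r s.r
  iseqv :=
    { refl := by
        rintro (x | y)
        · exact Sum.LiftRel.inl (r.refl x)
        · exact Sum.LiftRel.inr (s.refl y)
      symm := by
        rintro _ _ (h | h)
        · exact Sum.LiftRel.inl (r.symm h)
        · exact Sum.LiftRel.inr (s.symm h)
      trans := by
        rintro _ _ _ (h | h) (h' | h')
        · exact Sum.LiftRel.inl (r.trans h h')
        · exact Sum.LiftRel.inr (s.trans h h') }

namespace Setoid

variable {X Y : Type*}

theorem le_mergeClasses (r : Setoid X) (x y : X) : r ≤ r.mergeClasses x y := le_sup_left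

theorem mergeClasses_rel (r : Setoid X) (x y : X) : r.mergeClasses x y x y :=
  (le_sup_right : _ ≤ r.mergeClasses x y) (Relation.EqvGen.rel _ _ ⟨rfl, rfl⟩)

end Setoid

namespace ArrowPresentation

variable {X Y E F : Type*}

/-- Two points are equivalent if they lie on the same circle. -/
def vertexSetoid (G : ArrowPresentation X E) : Setoid X :=
  Relation.EqvGen.setoid (fun x y => y = G.gap x ∨ y = G.seg x)

/-- The vertices, i.e. the circles. -/
def Vertex (G : ArrowPresentation X E) : Type _ := Quotient G.vertexSetoid

/-- One step along a boundary component: along a gap arc, or along a segment without arrow, or, at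
an edge, along a new curve that joins the tail of one of its two arrows to the head of the other. -/
def boundaryStep (G : ArrowPresentation X E) (x y : X) : Prop :=
  y = G.gap x ∨
  (∃ e ∈ G.edges, ∃ i, x = G.pt e i false ∧ y = G.pt e (!i) true) ∨
  ((∀ e ∈ G.edges, ∀ i s, x ≠ G.pt e i s) ∧ y = G.seg x)

/-- Two points are equivalent if they lie on the same boundary component. -/
def boundarySetoid (G : ArrowPresentation X E) : Setoid X :=
  Relation.EqvGen.setoid G.boundaryStep

theorem seg_pt' (G : ArrowPresentation X E) {e : E} (he : e ∈ G.edges) (i s : Bool) :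
    G.seg (G.pt e i s) = G.pt e i (!s) := by
  cases s
  · exact G.seg_pt e he i
  · rw [← G.seg_pt e he i, G.seg_seg]; rfl

open Classical in
/-- Remove the two arrows `p₁p₂` (number `false`) and `q₁q₂` (number `true`) of the edge `e` and
their segments, then join `p₁` to the end `pt e i s` of a removed segment, and the two remaining
ends to each other, by segments without arrows. Conjugation by a transposition does this: it leaves
`seg` as it is away from `e`, and turns the pairs `p₁ p₂`, `q₁ q₂` into
* `p₁ p₂`, `q₁ q₂` for `pt e i s = p₂`,
* `p₁ q₂`, `q₁ p₂` for `pt e i s = q₂`,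
* `p₁ q₁`, `p₂ q₂` for `pt e i s = q₁`. -/
noncomputable def rejoin (G : ArrowPresentation X E) (e : E) (he : e ∈ G.edges) (i s : Bool) :
    ArrowPresentation X E where
  gap := G.gap
  seg := Equiv.swap (G.pt e false true) (G.pt e i s) * G.seg *
    Equiv.swap (G.pt e false true) (G.pt e i s)
  gap_gap := G.gap_gap
  gap_ne := G.gap_ne
  seg_seg x := by simp [G.seg_seg]
  seg_ne x h := G.seg_ne (Equiv.swap (G.pt e false true) (G.pt e i s) x) (by
    have := congrArg (Equiv.swap (G.pt e false true) (G.pt e i s)) h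
    simpa using this)
  edges := G.edges.erase e
  pt := G.pt
  pt_inj a ha b hb := G.pt_inj a (Finset.mem_of_mem_erase ha) b (Finset.mem_of_mem_erase hb)
  seg_pt a ha j := by
    have hne : a ≠ e := Finset.ne_of_mem_erase ha
    have ha' := Finset.mem_of_mem_erase ha
    have key : ∀ t k u, G.pt a j t ≠ G.pt e k u := fun t k u h =>
      hne (G.pt_inj a ha' e he _ _ _ _ h).1
    rw [Equiv.Perm.mul_apply, Equiv.Perm.mul_apply,
      Equiv.swap_apply_of_ne_of_ne (key _ _ _) (key _ _ _), G.seg_pt a ha' j,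
      Equiv.swap_apply_of_ne_of_ne (key _ _ _) (key _ _ _)]

/-- Deletion: `p₁` stays joined to `p₂`, and `q₁` to `q₂`; only the arrows are removed. -/
noncomputable def delete (G : ArrowPresentation X E) (e : E) (he : e ∈ G.edges) :
    ArrowPresentation X E := G.rejoin e he false true

/-- Contraction: `p₁` is joined to `q₂`, and `p₂` to `q₁`. -/
noncomputable def contract (G : ArrowPresentation X E) (e : E) (he : e ∈ G.edges) :
    ArrowPresentation X E := G.rejoin e he true true

/-- Penrose-contraction: `p₁` is joined to `q₁`, and `p₂` to `q₂`. -/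
noncomputable def penrose (G : ArrowPresentation X E) (e : E) (he : e ∈ G.edges) :
    ArrowPresentation X E := G.rejoin e he true false

theorem rejoin_seg_of_ne (G : ArrowPresentation X E) {e : E} (he : e ∈ G.edges) (i s : Bool)
    {x : X} (hx : ∀ j t, x ≠ G.pt e j t) : (G.rejoin e he i s).seg x = G.seg x := by
  classical
  have h2 : ∀ j t, G.seg x ≠ G.pt e j t := fun j t h => hx j (!t) (by
    rw [← G.seg_pt' he, ← h, G.seg_seg])
  simp only [rejoin, Equiv.Perm.mul_apply]
  rw [Equiv.swap_apply_of_ne_of_ne (hx _ _) (hx _ _), Equiv.swap_apply_of_ne_of_ne (h2 _ _) (h2 _ _)]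

theorem pt_inj_iff (G : ArrowPresentation X E) {e : E} (he : e ∈ G.edges) (i s j t : Bool) :
    G.pt e i s = G.pt e j t ↔ i = j ∧ s = t :=
  ⟨fun h => (G.pt_inj e he e he _ _ _ _ h).2, by rintro ⟨rfl, rfl⟩; rfl⟩

theorem delete_seg (G : ArrowPresentation X E) {e : E} (he : e ∈ G.edges) :
    (G.delete e he).seg = G.seg := by
  simp only [delete, rejoin, Equiv.swap_self]
  rfl

theorem contract_seg_pt (G : ArrowPresentation X E) {e : E} (he : e ∈ G.edges) (i s : Bool) :
    (G.contract e he).seg (G.pt e i s) = G.pt e (!i) (!s) := by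
  cases i <;> cases s <;>
    simp [contract, rejoin, Equiv.swap_apply_def, G.seg_pt' he, G.pt_inj_iff he]

theorem penrose_seg_pt (G : ArrowPresentation X E) {e : E} (he : e ∈ G.edges) (i s : Bool) :
    (G.penrose e he).seg (G.pt e i s) = G.pt e (!i) s := by
  cases i <;> cases s <;>
    simp [penrose, rejoin, Equiv.swap_apply_def, G.seg_pt' he, G.pt_inj_iff he]

theorem rejoin_seg_pt (G : ArrowPresentation X E) {e : E} (he : e ∈ G.edges) (k u i s : Bool) :
    ∃ j t, (G.rejoin e he k u).seg (G.pt e i s) = G.pt e j t := by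
  classical
  simp only [rejoin, Equiv.Perm.mul_apply]
  have key : ∀ j t, ∃ j' t', Equiv.swap (G.pt e false true) (G.pt e k u) (G.pt e j t) =
      G.pt e j' t' := by
    intro j t
    rw [Equiv.swap_apply_def]
    split_ifs
    exacts [⟨_, _, rfl⟩, ⟨_, _, rfl⟩, ⟨_, _, rfl⟩]
  obtain ⟨j, t, h⟩ := key i s
  rw [h, G.seg_pt' he]
  exact key _ _

open Classical in
/-- The 2-sum along the edges `f` of `G` and `e` of `H` with respect to the coupling `φ`, which
sends the `i`-th arrow of `f` to the `φ i`-th arrow of `e`. The four arrows and their segments are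
removed; each arrow's tail is then joined to the tail of its image, and its head to the head of its
image, by segments without arrows. (Conjugation by the transposition of the head of an arrow
and the tail of its image turns the pairs `p₁ p₂`, `q₁ q₂` into `p₁ q₁`, `p₂ q₂`.) -/
noncomputable def twoSum (G : ArrowPresentation X E) (H : ArrowPresentation Y F)
    (f : E) (hf : f ∈ G.edges) (e : F) (he : e ∈ H.edges) (φ : Bool ≃ Bool) :
    ArrowPresentation (X ⊕ Y) (E ⊕ F) where
  gap := Equiv.sumCongr G.gap H.gap
  seg :=
    Equiv.swap (Sum.inl (G.pt f true true)) (Sum.inr (H.pt e (φ true) false)) *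
    (Equiv.swap (Sum.inl (G.pt f false true)) (Sum.inr (H.pt e (φ false) false)) *
      Equiv.sumCongr G.seg H.seg *
      Equiv.swap (Sum.inl (G.pt f false true)) (Sum.inr (H.pt e (φ false) false))) *
    Equiv.swap (Sum.inl (G.pt f true true)) (Sum.inr (H.pt e (φ true) false))
  gap_gap := by rintro (x | y) <;> simp [G.gap_gap, H.gap_gap]
  gap_ne := by rintro (x | y) <;> simp [G.gap_ne, H.gap_ne]
  seg_seg x := by
    have h : ∀ z, Equiv.sumCongr G.seg H.seg (Equiv.sumCongr G.seg H.seg z) = z := by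
      rintro (x | y) <;> simp [G.seg_seg, H.seg_seg]
    simp only [Equiv.Perm.mul_apply, Equiv.swap_apply_self, h]
  seg_ne x h := by
    have hne : ∀ z, Equiv.sumCongr G.seg H.seg z ≠ z := by
      rintro (x | y) <;> simp [G.seg_ne, H.seg_ne]
    simp only [Equiv.Perm.mul_apply] at h
    rw [Equiv.swap_apply_eq_iff, Equiv.swap_apply_eq_iff] at h
    exact hne _ h
  edges := (G.edges.erase f).disjSum (H.edges.erase e)
  pt := Sum.elim (fun a i s => Sum.inl (G.pt a i s)) (fun a i s => Sum.inr (H.pt a i s))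
  pt_inj := by
    rintro (a | a) ha (b | b) hb i s j t h
    · have := G.pt_inj a (Finset.mem_of_mem_erase (Finset.inl_mem_disjSum.1 ha)) b
        (Finset.mem_of_mem_erase (Finset.inl_mem_disjSum.1 hb)) i s j t (Sum.inl_injective h)
      exact ⟨congrArg _ this.1, this.2⟩
    · exact absurd h (by simp)
    · exact absurd h (by simp)
    · have := H.pt_inj a (Finset.mem_of_mem_erase (Finset.inr_mem_disjSum.1 ha)) b
        (Finset.mem_of_mem_erase (Finset.inr_mem_disjSum.1 hb)) i s j t (Sum.inr_injective h)
      exact ⟨congrArg _ this.1, this.2⟩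
  seg_pt := by
    rintro (a | a) ha i
    · have ha' := Finset.inl_mem_disjSum.1 ha
      have key : ∀ t k u, G.pt a i t ≠ G.pt f k u := fun t k u h =>
        Finset.ne_of_mem_erase ha' (G.pt_inj a (Finset.mem_of_mem_erase ha') f hf _ _ _ _ h).1
      simp [Equiv.swap_apply_def, key, G.seg_pt a (Finset.mem_of_mem_erase ha') i]
    · have ha' := Finset.inr_mem_disjSum.1 ha
      have key : ∀ t k u, H.pt a i t ≠ H.pt e k u := fun t k u h =>
        Finset.ne_of_mem_erase ha' (H.pt_inj a (Finset.mem_of_mem_erase ha') e he _ _ _ _ h).1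
      simp [Equiv.swap_apply_def, key, H.seg_pt a (Finset.mem_of_mem_erase ha') i]

theorem twoSum_seg_inl_pt (G : ArrowPresentation X E) (H : ArrowPresentation Y F)
    (f : E) (hf : f ∈ G.edges) (e : F) (he : e ∈ H.edges) (φ : Bool ≃ Bool) (i s : Bool) :
    (G.twoSum H f hf e he φ).seg (Sum.inl (G.pt f i s)) = Sum.inr (H.pt e (φ i) s) := by
  cases i <;> cases s <;>
    simp [twoSum, Equiv.swap_apply_def, G.seg_pt' hf, H.seg_pt' he, G.pt_inj_iff hf,
      H.pt_inj_iff he]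

theorem twoSum_seg_inr_pt (G : ArrowPresentation X E) (H : ArrowPresentation Y F)
    (f : E) (hf : f ∈ G.edges) (e : F) (he : e ∈ H.edges) (φ : Bool ≃ Bool) (i s : Bool) :
    (G.twoSum H f hf e he φ).seg (Sum.inr (H.pt e (φ i) s)) = Sum.inl (G.pt f i s) := by
  rw [← G.twoSum_seg_inl_pt H f hf e he φ, seg_seg]

theorem twoSum_seg_inl (G : ArrowPresentation X E) (H : ArrowPresentation Y F)
    (f : E) (hf : f ∈ G.edges) (e : F) (he : e ∈ H.edges) (φ : Bool ≃ Bool) {x : X}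
    (hx : ∀ i s, x ≠ G.pt f i s) :
    (G.twoSum H f hf e he φ).seg (Sum.inl x) = Sum.inl (G.seg x) := by
  have h2 : ∀ j t, G.seg x ≠ G.pt f j t := fun j t h => hx j (!t) (by
    rw [← G.seg_pt' hf, ← h, G.seg_seg])
  simp [twoSum, Equiv.swap_apply_def, hx, h2]

theorem twoSum_seg_inr (G : ArrowPresentation X E) (H : ArrowPresentation Y F)
    (f : E) (hf : f ∈ G.edges) (e : F) (he : e ∈ H.edges) (φ : Bool ≃ Bool) {y : Y}
    (hy : ∀ i s, y ≠ H.pt e i s) :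
    (G.twoSum H f hf e he φ).seg (Sum.inr y) = Sum.inr (H.seg y) := by
  have h2 : ∀ j t, H.seg y ≠ H.pt e j t := fun j t h => hy j (!t) (by
    rw [← H.seg_pt' he, ← h, H.seg_seg])
  simp [twoSum, Equiv.swap_apply_def, hy, h2]

end ArrowPresentation

/-- A packaged arrow presentation. A partition of the set of vertices (circles) is given as an
equivalence relation on the points that relates any two points of the same circle, and a partition
of the set of boundary components likewise. -/
@[ext] structure PackagedArrowPresentation (X : Type*) (E : Type*)
    extends ArrowPresentation X E where
  vpart : Setoid X
  bpart : Setoid X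
  vertex_le : toArrowPresentation.vertexSetoid ≤ vpart
  boundary_le : toArrowPresentation.boundarySetoid ≤ bpart

namespace PackagedArrowPresentation

variable {X Y E F : Type*}

theorem vpart_gap (G : PackagedArrowPresentation X E) (x : X) : G.vpart x (G.gap x) :=
  G.vertex_le (Relation.EqvGen.rel _ _ (Or.inl rfl))

theorem vpart_seg (G : PackagedArrowPresentation X E) (x : X) : G.vpart x (G.seg x) :=
  G.vertex_le (Relation.EqvGen.rel _ _ (Or.inr rfl))

theorem bpart_gap (G : PackagedArrowPresentation X E) (x : X) : G.bpart x (G.gap x) :=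
  G.boundary_le (Relation.EqvGen.rel _ _ (Or.inl rfl))

theorem bpart_pt (G : PackagedArrowPresentation X E) {e : E} (he : e ∈ G.edges) (i s : Bool) :
    G.bpart (G.pt e i s) (G.pt e (!i) (!s)) := by
  cases s
  · exact G.boundary_le (Relation.EqvGen.rel _ _ (Or.inr (Or.inl ⟨e, he, i, rfl, rfl⟩)))
  · refine G.bpart.symm (G.boundary_le (Relation.EqvGen.rel _ _
      (Or.inr (Or.inl ⟨e, he, !i, rfl, ?_⟩))))
    rw [Bool.not_not]

theorem vpart_merge_pt (G : PackagedArrowPresentation X E) {e : E} (he : e ∈ G.edges)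
    (i s j t : Bool) :
    G.vpart.mergeClasses (G.pt e false false) (G.pt e true false) (G.pt e i s) (G.pt e j t) := by
  set R := G.vpart.mergeClasses (G.pt e false false) (G.pt e true false) with hR
  have h1 : ∀ i, R (G.pt e i false) (G.pt e i true) := fun i =>
    G.vpart.le_mergeClasses _ _ (G.seg_pt e he i ▸ G.vpart_seg _)
  have h0 : R (G.pt e false false) (G.pt e true false) := G.vpart.mergeClasses_rel _ _
  have key : ∀ i s, R (G.pt e false false) (G.pt e i s) := by
    rintro (_ | _) (_ | _)
    exacts [R.refl _, h1 _, h0, R.trans h0 (h1 _)]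
  exact R.trans (R.symm (key i s)) (key j t)

theorem bpart_merge_pt (G : PackagedArrowPresentation X E) {e : E} (he : e ∈ G.edges)
    (i s j t : Bool) :
    G.bpart.mergeClasses (G.pt e false false) (G.pt e true false) (G.pt e i s) (G.pt e j t) := by
  set R := G.bpart.mergeClasses (G.pt e false false) (G.pt e true false) with hR
  have h1 : ∀ i s, R (G.pt e i s) (G.pt e (!i) (!s)) := fun i s =>
    G.bpart.le_mergeClasses _ _ (G.bpart_pt he i s)
  have h0 : R (G.pt e false false) (G.pt e true false) := G.bpart.mergeClasses_rel _ _
  have key : ∀ i s, R (G.pt e false false) (G.pt e i s) := by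
    rintro (_ | _) (_ | _)
    exacts [R.refl _, R.trans h0 (h1 _ _), h0, h1 _ _]
  exact R.trans (R.symm (key i s)) (key j t)

theorem rejoin_vertex_le (G : PackagedArrowPresentation X E) {e : E} (he : e ∈ G.edges)
    (i s : Bool) : (G.rejoin e he i s).vertexSetoid ≤
      G.vpart.mergeClasses (G.pt e false false) (G.pt e true false) := by
  refine Setoid.eqvGen_le ?_
  rintro x y (rfl | rfl)
  · exact G.vpart.le_mergeClasses _ _ (G.vpart_gap x)
  · by_cases hx : ∃ j t, x = G.pt e j t
    · obtain ⟨j, t, rfl⟩ := hx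
      obtain ⟨j', t', h⟩ := G.rejoin_seg_pt he i s j t
      rw [h]
      exact G.vpart_merge_pt he _ _ _ _
    · push Not at hx
      rw [G.rejoin_seg_of_ne he i s hx]
      exact G.vpart.le_mergeClasses _ _ (G.vpart_seg x)

theorem rejoin_boundary_le (G : PackagedArrowPresentation X E) {e : E} (he : e ∈ G.edges)
    (i s : Bool) : (G.rejoin e he i s).boundarySetoid ≤
      G.bpart.mergeClasses (G.pt e false false) (G.pt e true false) := by
  classical
  refine Setoid.eqvGen_le ?_
  rintro x y (rfl | ⟨a, ha, j, rfl, rfl⟩ | ⟨hx', rfl⟩)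
  · exact G.bpart.le_mergeClasses _ _ (G.bpart_gap x)
  · exact G.bpart.le_mergeClasses _ _ (G.bpart_pt (Finset.mem_of_mem_erase ha) j false)
  · by_cases hx : ∃ j t, x = G.pt e j t
    · obtain ⟨j, t, rfl⟩ := hx
      obtain ⟨j', t', h⟩ := G.rejoin_seg_pt he i s j t
      rw [h]
      exact G.bpart_merge_pt he _ _ _ _
    · push Not at hx
      rw [G.rejoin_seg_of_ne he i s hx]
      refine G.bpart.le_mergeClasses _ _ (G.boundary_le (Relation.EqvGen.rel _ _
        (Or.inr (Or.inr ⟨fun a ha j t h => ?_, rfl⟩))))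
      by_cases hae : a = e
      · subst hae; exact hx _ _ h
      · exact hx' a (Finset.mem_erase.2 ⟨hae, ha⟩) j t h

theorem delete_vertex_le (G : PackagedArrowPresentation X E) {e : E} (he : e ∈ G.edges) :
    (G.toArrowPresentation.delete e he).vertexSetoid ≤ G.vpart := by
  refine Setoid.eqvGen_le ?_
  rintro x y (rfl | rfl)
  · exact G.vpart_gap x
  · rw [G.delete_seg he]; exact G.vpart_seg x

theorem contract_boundary_le (G : PackagedArrowPresentation X E) {e : E} (he : e ∈ G.edges) :
    (G.toArrowPresentation.contract e he).boundarySetoid ≤ G.bpart := by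
  classical
  refine Setoid.eqvGen_le ?_
  rintro x y (rfl | ⟨a, ha, j, rfl, rfl⟩ | ⟨hx', rfl⟩)
  · exact G.bpart_gap x
  · exact G.bpart_pt (Finset.mem_of_mem_erase ha) j false
  · by_cases hx : ∃ j t, x = G.pt e j t
    · obtain ⟨j, t, rfl⟩ := hx
      rw [G.contract_seg_pt he]
      exact G.bpart_pt he _ _
    · push Not at hx
      rw [ArrowPresentation.contract, G.rejoin_seg_of_ne he _ _ hx]
      refine G.boundary_le (Relation.EqvGen.rel _ _
        (Or.inr (Or.inr ⟨fun a ha j t h => ?_, rfl⟩)))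
      by_cases hae : a = e
      · subst hae; exact hx _ _ h
      · exact hx' a (Finset.mem_erase.2 ⟨hae, ha⟩) j t h

/-! In the five operations, `p₁ = pt e false false` lies on the vertex `u` and on the boundary
component `a`, and `q₁ = pt e true false` lies on the vertex `v` and on the boundary component `b`.
No point is lost, and the circles (boundary components) that an operation creates consist of the
points of the ones it destroys, so uniting the classes of `p₁` and `q₁` gives the new class. -/

/-- Delete `e`: the boundary classes at `e` are united. -/
noncomputable def delete (G : PackagedArrowPresentation X E) (e : E) (he : e ∈ G.edges) :
    PackagedArrowPresentation X E where
  toArrowPresentation := G.toArrowPresentation.delete e he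
  vpart := G.vpart
  bpart := G.bpart.mergeClasses (G.pt e false false) (G.pt e true false)
  vertex_le := G.delete_vertex_le he
  boundary_le := G.rejoin_boundary_le he _ _

/-- Contract `e`: the vertex classes at `e` are united. -/
noncomputable def contract (G : PackagedArrowPresentation X E) (e : E) (he : e ∈ G.edges) :
    PackagedArrowPresentation X E where
  toArrowPresentation := G.toArrowPresentation.contract e he
  vpart := G.vpart.mergeClasses (G.pt e false false) (G.pt e true false)
  bpart := G.bpart
  vertex_le := G.rejoin_vertex_le he _ _
  boundary_le := G.contract_boundary_le he

/-- Penrose-contract `e`: the vertex classes and the boundary classes at `e` are united. -/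
noncomputable def penrose (G : PackagedArrowPresentation X E) (e : E) (he : e ∈ G.edges) :
    PackagedArrowPresentation X E where
  toArrowPresentation := G.toArrowPresentation.penrose e he
  vpart := G.vpart.mergeClasses (G.pt e false false) (G.pt e true false)
  bpart := G.bpart.mergeClasses (G.pt e false false) (G.pt e true false)
  vertex_le := G.rejoin_vertex_le he _ _
  boundary_le := G.rejoin_boundary_le he _ _

/-- Merge-delete `e`: delete, and also unite the vertex classes at `e`. -/
noncomputable def mergeDelete (G : PackagedArrowPresentation X E) (e : E) (he : e ∈ G.edges) :
    PackagedArrowPresentation X E where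
  toArrowPresentation := G.toArrowPresentation.delete e he
  vpart := G.vpart.mergeClasses (G.pt e false false) (G.pt e true false)
  bpart := G.bpart.mergeClasses (G.pt e false false) (G.pt e true false)
  vertex_le := G.rejoin_vertex_le he _ _
  boundary_le := G.rejoin_boundary_le he _ _

/-- Merge-contract `e`: contract, and also unite the boundary classes at `e`. -/
noncomputable def mergeContract (G : PackagedArrowPresentation X E) (e : E) (he : e ∈ G.edges) :
    PackagedArrowPresentation X E where
  toArrowPresentation := G.toArrowPresentation.contract e he
  vpart := G.vpart.mergeClasses (G.pt e false false) (G.pt e true false)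
  bpart := G.bpart.mergeClasses (G.pt e false false) (G.pt e true false)
  vertex_le := G.rejoin_vertex_le he _ _
  boundary_le := G.rejoin_boundary_le he _ _

/-- The 2-sum of packaged arrow presentations. If the coupling sends `p₁p₂` to `q₁q₂` and `p₃p₄` to
`q₃q₄`, the vertex classes of `p₁` and `q₁` are united, as are those of `p₃` and `q₃`; likewise the
boundary classes of `p₁` and `q₁` (those of the components through `p₁, p₄` and `q₁, q₄`) and of `p₃`
and `q₃` (those of the components through `p₂, p₃` and `q₂, q₃`). -/
noncomputable def twoSum (G : PackagedArrowPresentation X E) (H : PackagedArrowPresentation Y F)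
    (f : E) (hf : f ∈ G.edges) (e : F) (he : e ∈ H.edges) (φ : Bool ≃ Bool) :
    PackagedArrowPresentation (X ⊕ Y) (E ⊕ F) where
  toArrowPresentation := G.toArrowPresentation.twoSum H.toArrowPresentation f hf e he φ
  vpart := ((G.vpart.disjUnion H.vpart).mergeClasses
      (Sum.inl (G.pt f false false)) (Sum.inr (H.pt e (φ false) false))).mergeClasses
      (Sum.inl (G.pt f true false)) (Sum.inr (H.pt e (φ true) false))
  bpart := ((G.bpart.disjUnion H.bpart).mergeClasses
      (Sum.inl (G.pt f false false)) (Sum.inr (H.pt e (φ false) false))).mergeClasses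
      (Sum.inl (G.pt f true false)) (Sum.inr (H.pt e (φ true) false))
  vertex_le := by
    set R := ((G.vpart.disjUnion H.vpart).mergeClasses
      (Sum.inl (G.pt f false false)) (Sum.inr (H.pt e (φ false) false))).mergeClasses
      (Sum.inl (G.pt f true false)) (Sum.inr (H.pt e (φ true) false)) with hR
    have hle : G.vpart.disjUnion H.vpart ≤ R :=
      (Setoid.le_mergeClasses _ _ _).trans (Setoid.le_mergeClasses _ _ _)
    have hl : ∀ {x x'}, G.vpart x x' → R (Sum.inl x) (Sum.inl x') := fun h =>
      hle (Sum.LiftRel.inl h)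
    have hr : ∀ {y y'}, H.vpart y y' → R (Sum.inr y) (Sum.inr y') := fun h =>
      hle (Sum.LiftRel.inr h)
    have h0 : ∀ i, R (Sum.inl (G.pt f i false)) (Sum.inr (H.pt e (φ i) false)) := by
      rintro (_ | _)
      · exact Setoid.le_mergeClasses _ _ _ (Setoid.mergeClasses_rel _ _ _)
      · exact Setoid.mergeClasses_rel _ _ _
    have h1 : ∀ i s, R (Sum.inl (G.pt f i s)) (Sum.inr (H.pt e (φ i) s)) := by
      rintro i (_ | _)
      · exact h0 i
      · exact R.trans (R.symm (hl (G.seg_pt f hf i ▸ G.vpart_seg _)))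
          (R.trans (h0 i) (hr (H.seg_pt e he (φ i) ▸ H.vpart_seg _)))
    refine Setoid.eqvGen_le ?_
    rintro (x | y) z (rfl | rfl)
    · exact hl (G.vpart_gap x)
    · by_cases hx : ∃ i s, x = G.pt f i s
      · obtain ⟨i, s, rfl⟩ := hx
        rw [ArrowPresentation.twoSum_seg_inl_pt]
        exact h1 i s
      · push Not at hx
        rw [ArrowPresentation.twoSum_seg_inl _ _ _ _ _ _ _ hx]
        exact hl (G.vpart_seg x)
    · exact hr (H.vpart_gap y)
    · by_cases hy : ∃ i s, y = H.pt e i s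
      · obtain ⟨i, s, rfl⟩ := hy
        obtain ⟨i, rfl⟩ := φ.surjective i
        rw [ArrowPresentation.twoSum_seg_inr_pt]
        exact R.symm (h1 i s)
      · push Not at hy
        rw [ArrowPresentation.twoSum_seg_inr _ _ _ _ _ _ _ hy]
        exact hr (H.vpart_seg y)
  boundary_le := by
    classical
    set R := ((G.bpart.disjUnion H.bpart).mergeClasses
      (Sum.inl (G.pt f false false)) (Sum.inr (H.pt e (φ false) false))).mergeClasses
      (Sum.inl (G.pt f true false)) (Sum.inr (H.pt e (φ true) false)) with hR
    have hle : G.bpart.disjUnion H.bpart ≤ R :=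
      (Setoid.le_mergeClasses _ _ _).trans (Setoid.le_mergeClasses _ _ _)
    have hl : ∀ {x x'}, G.bpart x x' → R (Sum.inl x) (Sum.inl x') := fun h =>
      hle (Sum.LiftRel.inl h)
    have hr : ∀ {y y'}, H.bpart y y' → R (Sum.inr y) (Sum.inr y') := fun h =>
      hle (Sum.LiftRel.inr h)
    have h0 : ∀ i, R (Sum.inl (G.pt f i false)) (Sum.inr (H.pt e (φ i) false)) := by
      rintro (_ | _)
      · exact Setoid.le_mergeClasses _ _ _ (Setoid.mergeClasses_rel _ _ _)
      · exact Setoid.mergeClasses_rel _ _ _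
    have hφ : ∀ i, φ (!i) = !(φ i) := by
      intro i
      have : φ (!i) ≠ φ i := fun h => by simpa using φ.injective h
      revert this
      cases φ (!i) <;> cases φ i <;> simp
    have h1 : ∀ i s, R (Sum.inl (G.pt f i s)) (Sum.inr (H.pt e (φ i) s)) := by
      rintro i (_ | _)
      · exact h0 i
      · have a1 := hl (G.bpart_pt hf i true)
        have a2 := hr (H.bpart_pt he (φ i) true)
        rw [← hφ] at a2
        exact R.trans a1 (R.trans (h0 (!i)) (R.symm a2))
    refine Setoid.eqvGen_le ?_
    rintro x y (rfl | ⟨a, ha, j, rfl, rfl⟩ | ⟨hx', rfl⟩)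
    · rcases x with x | y
      · exact hl (G.bpart_gap x)
      · exact hr (H.bpart_gap y)
    · rcases a with a | a
      · exact hl (G.bpart_pt (Finset.mem_of_mem_erase (Finset.inl_mem_disjSum.1 ha)) j false)
      · exact hr (H.bpart_pt (Finset.mem_of_mem_erase (Finset.inr_mem_disjSum.1 ha)) j false)
    · rcases x with x | y
      · by_cases hx : ∃ i s, x = G.pt f i s
        · obtain ⟨i, s, rfl⟩ := hx
          rw [ArrowPresentation.twoSum_seg_inl_pt]
          exact h1 i s
        · push Not at hx
          rw [ArrowPresentation.twoSum_seg_inl _ _ _ _ _ _ _ hx]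
          refine hl (G.boundary_le (Relation.EqvGen.rel _ _
            (Or.inr (Or.inr ⟨fun a ha j t h => ?_, rfl⟩))))
          by_cases hae : a = f
          · subst hae; exact hx _ _ h
          · exact hx' (Sum.inl a) (Finset.inl_mem_disjSum.2 (Finset.mem_erase.2 ⟨hae, ha⟩)) j t
              (congrArg Sum.inl h)
      · by_cases hy : ∃ i s, y = H.pt e i s
        · obtain ⟨i, s, rfl⟩ := hy
          obtain ⟨i, rfl⟩ := φ.surjective i
          rw [ArrowPresentation.twoSum_seg_inr_pt]
          exact R.symm (h1 i s)
        · push Not at hy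
          rw [ArrowPresentation.twoSum_seg_inr _ _ _ _ _ _ _ hy]
          refine hr (H.boundary_le (Relation.EqvGen.rel _ _
            (Or.inr (Or.inr ⟨fun a ha j t h => ?_, rfl⟩))))
          by_cases hae : a = e
          · subst hae; exact hy _ _ h
          · exact hx' (Sum.inr a) (Finset.inr_mem_disjSum.2 (Finset.mem_erase.2 ⟨hae, ha⟩)) j t
              (congrArg Sum.inr h)

end PackagedArrowPresentation

/-- The eight variables of the polynomial `Q`. -/
inductive QVar
  | a | b | c | x | y | α | β | γ

/-- The ring `ℤ[a, b, c, x, y, α, β, γ]`. -/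
abbrev QRing : Type := MvPolynomial QVar ℤ

namespace PackagedArrowPresentation

variable {X E : Type*}

/-- `α ^ |V| * β ^ |𝒱| * γ ^ |ℬ|`, where `|V|` is the number of vertices, `|𝒱|` the number of
vertex classes and `|ℬ|` the number of boundary classes. -/
noncomputable def edgelessValue (G : PackagedArrowPresentation X E) : QRing :=
  MvPolynomial.X QVar.α ^ Nat.card G.Vertex *
    MvPolynomial.X QVar.β ^ Nat.card (Quotient G.vpart) *
    MvPolynomial.X QVar.γ ^ Nat.card (Quotient G.bpart)

/-- The defining property of the map `Q`: the expansion at any edge, and the value without edges. -/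
def IsQ (q : PackagedArrowPresentation X E → QRing) : Prop :=
  (∀ (G : PackagedArrowPresentation X E) (e : E) (he : e ∈ G.edges),
    q G = MvPolynomial.X QVar.a * q (G.delete e he) + MvPolynomial.X QVar.b * q (G.contract e he) +
      MvPolynomial.X QVar.c * q (G.penrose e he) + MvPolynomial.X QVar.x * q (G.mergeDelete e he) +
      MvPolynomial.X QVar.y * q (G.mergeContract e he)) ∧
  (∀ G : PackagedArrowPresentation X E, G.edges = ∅ → q G = G.edgelessValue)

/-! ### Existence and uniqueness of the map `Q` -/

/-- The five operations as one family, and the variables that belong to them. -/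
noncomputable def op (k : Fin 5) (G : PackagedArrowPresentation X E) (e : E) (he : e ∈ G.edges) :
    PackagedArrowPresentation X E :=
  match k with
  | 0 => G.delete e he
  | 1 => G.contract e he
  | 2 => G.penrose e he
  | 3 => G.mergeDelete e he
  | 4 => G.mergeContract e he

/-- The variable that belongs to an operation. -/
def opVar : Fin 5 → QVar := ![QVar.a, QVar.b, QVar.c, QVar.x, QVar.y]

open Classical in
theorem op_edges (k : Fin 5) (G : PackagedArrowPresentation X E) (e : E) (he : e ∈ G.edges) :
    (op k G e he).edges = G.edges.erase e := by
  fin_cases k <;> rfl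

theorem swap_conj_comm [DecidableEq X] (σ : Equiv.Perm X) {p z p' z' : X} (h1 : p ≠ p')
    (h2 : p ≠ z') (h3 : z ≠ p') (h4 : z ≠ z') :
    Equiv.swap p' z' * (Equiv.swap p z * σ * Equiv.swap p z) * Equiv.swap p' z' =
      Equiv.swap p z * (Equiv.swap p' z' * σ * Equiv.swap p' z') * Equiv.swap p z := by
  have hc : Commute (Equiv.swap p z) (Equiv.swap p' z') := by
    apply Equiv.Perm.Disjoint.commute
    intro x
    by_cases hp : x = p
    · exact Or.inr (by subst hp; exact Equiv.swap_apply_of_ne_of_ne h1 h2)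
    · by_cases hz : x = z
      · exact Or.inr (by subst hz; exact Equiv.swap_apply_of_ne_of_ne h3 h4)
      · exact Or.inl (Equiv.swap_apply_of_ne_of_ne hp hz)
  calc _ = (Equiv.swap p' z' * Equiv.swap p z) * σ * (Equiv.swap p z * Equiv.swap p' z') := by
        group
    _ = (Equiv.swap p z * Equiv.swap p' z') * σ * (Equiv.swap p' z' * Equiv.swap p z) := by
        rw [hc.eq]
    _ = _ := by group

theorem op_comm (k l : Fin 5) (G : PackagedArrowPresentation X E) (e f : E) (he : e ∈ G.edges)
    (hf : f ∈ G.edges) (hfe : f ∈ (op k G e he).edges) (hef : e ∈ (op l G f hf).edges) :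
    op l (op k G e he) f hfe = op k (op l G f hf) e hef := by
  classical
  have hne : e ≠ f := by
    rw [op_edges] at hef
    exact Finset.ne_of_mem_erase hef
  have key : ∀ i s j t, G.pt e i s ≠ G.pt f j t := fun i s j t h =>
    hne (G.pt_inj e he f hf _ _ _ _ h).1
  have hm : ∀ (r : Setoid X) (x y x' y' : X),
      (r.mergeClasses x y).mergeClasses x' y' = (r.mergeClasses x' y').mergeClasses x y :=
    fun r x y x' y' => sup_right_comm _ _ _
  fin_cases k <;> fin_cases l <;>
  · apply PackagedArrowPresentation.ext
    · rfl
    · exact swap_conj_comm _ (key _ _ _ _) (key _ _ _ _) (key _ _ _ _) (key _ _ _ _)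
    · exact Finset.erase_right_comm
    · rfl
    · first | rfl | exact hm _ _ _ _ _
    · first | rfl | exact hm _ _ _ _ _

open Classical in
/-- Expansion at chosen edges, at most `n` times. -/
noncomputable def expand : ℕ → PackagedArrowPresentation X E → QRing
  | 0, G => G.edgelessValue
  | n + 1, G =>
    if h : G.edges.Nonempty then
      ∑ k, MvPolynomial.X (opVar k) * expand n (op k G h.choose h.choose_spec)
    else G.edgelessValue

theorem card_op_edges (k : Fin 5) (G : PackagedArrowPresentation X E) (e : E) (he : e ∈ G.edges)
    (n : ℕ) (h : G.edges.card = n + 1) : (op k G e he).edges.card = n := by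
  classical
  rw [op_edges, Finset.card_erase_of_mem he, h]
  rfl

theorem expand_succ (n : ℕ) (G : PackagedArrowPresentation X E) (hG : G.edges.card = n + 1)
    (e : E) (he : e ∈ G.edges) :
    expand (n + 1) G = ∑ k, MvPolynomial.X (opVar k) * expand n (op k G e he) := by
  classical
  induction n generalizing G e with
  | zero =>
    have h : G.edges.Nonempty := ⟨e, he⟩
    rw [expand, dif_pos h]
    have : h.choose = e := Finset.card_le_one.1 hG.le _ h.choose_spec _ he
    simp only [this]
  | succ n ih =>
    have h : G.edges.Nonempty := ⟨e, he⟩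
    rw [expand, dif_pos h]
    suffices H : ∀ g, ∀ hgm : g ∈ G.edges,
        ∑ k, MvPolynomial.X (opVar k) * expand (n + 1) (op k G g hgm) =
          ∑ k, MvPolynomial.X (opVar k) * expand (n + 1) (op k G e he) from H _ h.choose_spec
    intro g hgm
    by_cases hge : g = e
    · subst hge; rfl
    · have h1 : ∀ k, e ∈ (op k G g hgm).edges := fun k => by
        rw [op_edges]; exact Finset.mem_erase.2 ⟨fun h => hge h.symm, he⟩
      have h2 : ∀ k, g ∈ (op k G e he).edges := fun k => by
        rw [op_edges]; exact Finset.mem_erase.2 ⟨hge, hgm⟩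
      calc ∑ k, MvPolynomial.X (opVar k) * expand (n + 1) (op k G g hgm)
          = ∑ k, ∑ l, MvPolynomial.X (opVar k) * (MvPolynomial.X (opVar l) *
              expand n (op l (op k G g hgm) e (h1 k))) := by
            refine Finset.sum_congr rfl fun k _ => ?_
            rw [ih _ (card_op_edges k G g hgm _ hG) e (h1 k), Finset.mul_sum]
        _ = ∑ l, ∑ k, MvPolynomial.X (opVar l) * (MvPolynomial.X (opVar k) *
              expand n (op k (op l G e he) g (h2 l))) := by
            rw [Finset.sum_comm]
            refine Finset.sum_congr rfl fun l _ => Finset.sum_congr rfl fun k _ => ?_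
            rw [op_comm k l G g e hgm he (h1 k) (h2 l), mul_left_comm]
        _ = ∑ l, MvPolynomial.X (opVar l) * expand (n + 1) (op l G e he) := by
            refine Finset.sum_congr rfl fun l _ => ?_
            rw [ih _ (card_op_edges l G e he _ hG) g (h2 l), Finset.mul_sum]

theorem existsUnique_isQ : ∃! q : PackagedArrowPresentation X E → QRing, IsQ q := by
  classical
  refine ⟨fun G => expand G.edges.card G, ⟨fun G e he => ?_, fun G hG => ?_⟩, fun q hq => ?_⟩
  · obtain ⟨n, hn⟩ : ∃ n, G.edges.card = n + 1 :=
      ⟨_, (Nat.succ_pred_eq_of_pos (Finset.card_pos.2 ⟨e, he⟩)).symm⟩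
    have h := expand_succ n G hn e he
    have hc := fun k => card_op_edges k G e he n hn
    have h0 := hc 0
    have h1 := hc 1
    have h2 := hc 2
    have h3 := hc 3
    have h4 := hc 4
    simp only [op] at h0 h1 h2 h3 h4
    simp only [hn, h0, h1, h2, h3, h4]
    rw [h]
    simp [Fin.sum_univ_five, op, opVar]
  · simp [hG, expand]
  · have key : ∀ n, ∀ G : PackagedArrowPresentation X E, G.edges.card = n → q G = expand n G := by
      intro n
      induction n with
      | zero => exact fun G hG => hq.2 G (Finset.card_eq_zero.1 hG)
      | succ n ih =>
        intro G hG
        obtain ⟨e, he⟩ : G.edges.Nonempty := Finset.card_pos.1 (by omega)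
        have hc := fun k => ih _ (card_op_edges k G e he n hG)
        have h0 := hc 0
        have h1 := hc 1
        have h2 := hc 2
        have h3 := hc 3
        have h4 := hc 4
        simp only [op] at h0 h1 h2 h3 h4
        rw [hq.1 G e he, expand_succ n G hG e he, h0, h1, h2, h3, h4]
        simp [Fin.sum_univ_five, op, opVar]
    exact funext fun G => key _ G rfl

/-- The polynomial `Q(G; a, b, c, x, y, α, β, γ)`: `Q` is the unique map that satisfies `IsQ`. -/
noncomputable def Q (G : PackagedArrowPresentation X E) : QRing :=
  Classical.choose (existsUnique_isQ (X := X) (E := E)).exists G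

theorem isQ_Q : IsQ (Q : PackagedArrowPresentation X E → QRing) :=
  Classical.choose_spec (existsUnique_isQ (X := X) (E := E)).exists

/-- The vector of the five polynomials `Q` after the five operations at an edge. -/
noncomputable def qVec (G : PackagedArrowPresentation X E) (e : E) (he : e ∈ G.edges) :
    Fin 5 → QRing :=
  ![Q (G.delete e he), Q (G.contract e he), Q (G.penrose e he), Q (G.mergeDelete e he),
    Q (G.mergeContract e he)]

end PackagedArrowPresentation

/-- The matrix of the linear system for the `φ`'s. -/
noncomputable def systemMatrix : Matrix (Fin 5) (Fin 5) QRing :=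
  let α : QRing := MvPolynomial.X QVar.α
  let β : QRing := MvPolynomial.X QVar.β
  let γ : QRing := MvPolynomial.X QVar.γ
  (α * β * γ) •
    !![α * β, 1, 1, α, 1;
       1, α * γ, 1, 1, α;
       1, 1, α, 1, 1;
       α, 1, 1, α, 1;
       1, α, 1, 1, α]

/-! An operation at an edge `g` other than `f` and `e` commutes with the 2-sum (`op_twoSum_inl`,
`op_twoSum_inr`): it rejoins other ends, and uniting classes is a join of equivalence relations, so
order does not matter. Hence `Q` of the 2-sum obeys in `H` the same linear recursion as the
right-hand side `H.qVec e he` of the system, and solutions for the five presentations `op k H g hg`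
combine linearly to one for `H` (`exists_solution`). This reduces everything to an `H` whose only
edge is `e`.

Such an `H` behaves like a single operation. Outside `e`, its circles form paths that pair the four
ends of the two arrows in one of three ways (`exists_pairs`). Gluing `H` onto `f` therefore joins
the ends at `f` as deletion, contraction or Penrose-contraction does, up to additional circles.
Whether `H` puts its two arrows in one vertex class and in one boundary class decides which classes
at `f` get united. Of the conceivable combinations exactly five occur (`rel_of_pairs`), one for each
operation. Counting vertices and classes (`exists_op_of_single_edge`) gives a monomial `w` and an
index `t` such that the right-hand side of the system is `w` times column `t` of the matrix, while
the 2-sum has `w` times the value of `op t G f hf` when `f` is the only edge of `G`. The recursion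
in `G` extends this to all `G` (`Q_twoSum_single_edge`). So `w` times the `t`-th unit vector is a
solution.

Solutions built in this way have entries in the polynomial ring from the start. The determinant is
needed only to see that it is nonzero, which makes the solution unique over the field of fractions.
-/

namespace Setoid

/-! ### Counting classes under uniting and disjoint union -/

variable {X Y : Type*}

open Classical in
/-- Uniting the classes of `x` and `y` is the kernel of a map to the quotient. -/
theorem mergeClasses_eq_ker (r : Setoid X) (x y : X) :
    r.mergeClasses x y =
      ker (fun u => if r u x then (Quotient.mk r y) else Quotient.mk r u) := by
  apply le_antisymm
  · refine sup_le (fun u v h => ?_) (Setoid.eqvGen_le ?_)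
    · have h1 : r u x ↔ r v x := ⟨fun h' => r.trans (r.symm h) h', fun h' => r.trans h h'⟩
      have h2 : Quotient.mk r u = Quotient.mk r v := Quotient.sound h
      simp only [ker_def, h1, h2]
    · rintro u v ⟨rfl, rfl⟩
      simp only [ker_def, r.refl, if_true]
      split_ifs <;> rfl
  · intro u v h
    rw [ker_def] at h
    have hle := r.le_mergeClasses x y
    have hxy := r.mergeClasses_rel x y
    set R := r.mergeClasses x y
    split_ifs at h with h1 h2 h2
    · exact R.trans (hle h1) (R.symm (hle h2))
    · exact R.trans (hle h1) (R.trans hxy (hle (Quotient.exact h)))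
    · exact R.trans (hle (Quotient.exact h)) (R.trans (R.symm hxy) (R.symm (hle h2)))
    · exact hle (Quotient.exact h)

/-- One new link makes chains of length at most one necessary. Iterating this description lets
`simp` decide any relation in a partition obtained by several unitings. -/
theorem mergeClasses_apply (r : Setoid X) (x y u v : X) :
    r.mergeClasses x y u v ↔ r u v ∨ (r u x ∧ r v y) ∨ (r u y ∧ r v x) := by
  constructor
  · intro h
    rw [mergeClasses_eq_ker, ker_def] at h
    split_ifs at h with h1 h2 h2
    · exact Or.inl (r.trans h1 (r.symm h2))
    · exact Or.inr (Or.inl ⟨h1, r.symm (Quotient.exact h)⟩)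
    · exact Or.inr (Or.inr ⟨Quotient.exact h, h2⟩)
    · exact Or.inl (Quotient.exact h)
  · have hle := r.le_mergeClasses x y
    have hxy := r.mergeClasses_rel x y
    set R := r.mergeClasses x y
    rintro (h | ⟨h1, h2⟩ | ⟨h1, h2⟩)
    · exact hle h
    · exact R.trans (hle h1) (R.trans hxy (R.symm (hle h2)))
    · exact R.trans (hle h1) (R.trans (R.symm hxy) (R.symm (hle h2)))

theorem mergeClasses_eq_self {r : Setoid X} {x y : X} (h : r x y) : r.mergeClasses x y = r :=
  sup_eq_left.2 (eqvGen_le (by rintro _ _ ⟨rfl, rfl⟩; exact h))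

theorem mergeClasses_le {r t : Setoid X} {x y : X} (h : r ≤ t) (h' : t x y) :
    r.mergeClasses x y ≤ t :=
  sup_le h (eqvGen_le (by rintro _ _ ⟨rfl, rfl⟩; exact h'))

theorem card_mergeClasses [Finite X] {r : Setoid X} {x y : X} (h : ¬ r x y) :
    Nat.card (Quotient (r.mergeClasses x y)) + 1 = Nat.card (Quotient r) := by
  classical
  rw [mergeClasses_eq_ker, Nat.card_congr (quotientKerEquivRange _)]
  -- The collapsing map redirects the class of `x` to that of `y`, a different class, so its image
  -- misses the class of `x` and nothing else.
  have : Set.range (fun u => if r u x then (Quotient.mk r y) else Quotient.mk r u) =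
      {Quotient.mk r x}ᶜ := by
    ext q
    simp only [Set.mem_range, Set.mem_compl_iff, Set.mem_singleton_iff]
    constructor
    · rintro ⟨u, rfl⟩ h'
      split_ifs at h' with h1
      · exact h (r.symm (Quotient.exact h'))
      · exact h1 (Quotient.exact h')
    · intro h'
      induction q using Quotient.inductionOn with
      | h u => exact ⟨u, if_neg fun h1 => h' (Quotient.sound h1)⟩
  rw [this]
  have := Set.ncard_add_ncard_compl ({Quotient.mk r x} : Set (Quotient r))
  rw [Set.ncard_singleton, add_comm] at this
  exact this

open Classical in
theorem card_mergeClasses_add [Finite X] (r : Setoid X) (x y : X) :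
    Nat.card (Quotient (r.mergeClasses x y)) + (if r x y then 0 else 1) =
      Nat.card (Quotient r) := by
  split_ifs with h
  · rw [mergeClasses_eq_self h, add_zero]
  · exact card_mergeClasses h

@[simp] theorem disjUnion_inl_inl (r : Setoid X) (s : Setoid Y) (x x' : X) :
    r.disjUnion s (Sum.inl x) (Sum.inl x') ↔ r x x' := Sum.liftRel_inl_inl

@[simp] theorem disjUnion_inr_inr (r : Setoid X) (s : Setoid Y) (y y' : Y) :
    r.disjUnion s (Sum.inr y) (Sum.inr y') ↔ s y y' := Sum.liftRel_inr_inr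

@[simp] theorem not_disjUnion_inl_inr (r : Setoid X) (s : Setoid Y) (x : X) (y : Y) :
    ¬ r.disjUnion s (Sum.inl x) (Sum.inr y) := Sum.not_liftRel_inl_inr

@[simp] theorem not_disjUnion_inr_inl (r : Setoid X) (s : Setoid Y) (x : X) (y : Y) :
    ¬ r.disjUnion s (Sum.inr y) (Sum.inl x) := Sum.not_liftRel_inr_inl

theorem disjUnion_eq_ker (r : Setoid X) (s : Setoid Y) :
    r.disjUnion s = ker (Sum.map (Quotient.mk r) (Quotient.mk s)) := by
  ext (x | x) (y | y) <;> simp [ker_def, Quotient.eq]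

theorem card_disjUnion [Finite X] [Finite Y] (r : Setoid X) (s : Setoid Y) :
    Nat.card (Quotient (r.disjUnion s)) = Nat.card (Quotient r) + Nat.card (Quotient s) := by
  rw [disjUnion_eq_ker, Nat.card_congr (quotientKerEquivOfSurjective _
    (Sum.map_surjective.2 ⟨Quotient.mk_surjective, Quotient.mk_surjective⟩)), Nat.card_sum]

theorem disjUnion_le {r : Setoid X} {s : Setoid Y} {t : Setoid (X ⊕ Y)}
    (h : ∀ x x', r x x' → t (Sum.inl x) (Sum.inl x'))
    (h' : ∀ y y', s y y' → t (Sum.inr y) (Sum.inr y')) : r.disjUnion s ≤ t := by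
  rintro _ _ (h1 | h1)
  · exact h _ _ h1
  · exact h' _ _ h1

theorem disjUnion_mergeClasses_left (r : Setoid X) (s : Setoid Y) (x x' : X) :
    (r.mergeClasses x x').disjUnion s = (r.disjUnion s).mergeClasses (Sum.inl x) (Sum.inl x') := by
  ext (u | u) (v | v) <;> simp [mergeClasses_apply]

theorem disjUnion_mergeClasses_right (r : Setoid X) (s : Setoid Y) (y y' : Y) :
    r.disjUnion (s.mergeClasses y y') = (r.disjUnion s).mergeClasses (Sum.inr y) (Sum.inr y') := by
  ext (u | u) (v | v) <;> simp [mergeClasses_apply]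

theorem mergeClasses_right_comm (r : Setoid X) (x y x' y' : X) :
    (r.mergeClasses x y).mergeClasses x' y' = (r.mergeClasses x' y').mergeClasses x y :=
  sup_right_comm _ _ _

theorem mergeClasses_swap (r : Setoid X) (x y : X) :
    r.mergeClasses x y = r.mergeClasses y x := by
  ext u v
  simp only [mergeClasses_apply]
  tauto

/-- Gluing two partitions along two pairs of points, where the second one relates the points. -/
theorem card_glue_of_rel [Finite X] [Finite Y] (r : Setoid X) (s : Setoid Y) (x x' : X) {y y' : Y}
    (h : s y y') :
    Nat.card (Quotient (((r.disjUnion s).mergeClasses (Sum.inl x) (Sum.inr y)).mergeClasses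
      (Sum.inl x') (Sum.inr y'))) + 1 =
      Nat.card (Quotient (r.mergeClasses x x')) + Nat.card (Quotient s) := by
  classical
  have h1 := card_mergeClasses_add ((r.disjUnion s).mergeClasses (Sum.inl x) (Sum.inr y))
    (Sum.inl x') (Sum.inr y')
  have h2 := card_mergeClasses_add (r.disjUnion s) (Sum.inl x) (Sum.inr y)
  -- Since `s` relates `y` and `y'`, the second gluing is idle exactly when `r` relates `x'` and
  -- `x`; the same indicator governs the uniting of these two in `r`.
  have h3 := card_mergeClasses_add r x' x
  simp only [mergeClasses_apply, disjUnion_inl_inl, disjUnion_inr_inr, not_disjUnion_inl_inr,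
    not_disjUnion_inr_inl, s.symm h, and_true, false_or, or_false, and_false, card_disjUnion,
    if_false] at h1 h2
  rw [mergeClasses_swap r x x']
  omega

/-- Gluing two partitions along two pairs of points, where the second one separates the points. -/
theorem card_glue_of_not_rel [Finite X] [Finite Y] (r : Setoid X) (s : Setoid Y) (x x' : X)
    {y y' : Y} (h : ¬ s y y') :
    Nat.card (Quotient (((r.disjUnion s).mergeClasses (Sum.inl x) (Sum.inr y)).mergeClasses
      (Sum.inl x') (Sum.inr y'))) + 2 =
      Nat.card (Quotient r) + Nat.card (Quotient s) := by
  -- As `s` separates the two points, no chain through `Y` can make the second gluing idle, so each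
  -- gluing costs one class.
  have h' : ¬ s y' y := fun h' => h (s.symm h')
  rw [← card_disjUnion, ← card_mergeClasses (not_disjUnion_inl_inr r s x y),
    ← card_mergeClasses (r := (r.disjUnion s).mergeClasses (Sum.inl x) (Sum.inr y))
    (x := Sum.inl x') (y := Sum.inr y')]
  simp [mergeClasses_apply, h']

end Setoid

/-! ### Orbits of two involutions -/

/-- In an orbit of two involutions `a` and `b`, where `a` has no fixed point, there are either no
or exactly two fixed points of `b`. -/
theorem Equiv.Perm.exists_unique_other_fixed {X : Type*} [Finite X] (a b : Equiv.Perm X)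
    (ha : ∀ x, a (a x) = x) (hb : ∀ x, b (b x) = x) (hne : ∀ x, a x ≠ x) {x : X} (hx : b x = x) :
    ∃ y, y ≠ x ∧ b y = y ∧ Relation.EqvGen.setoid (fun u v => v = a u ∨ v = b u) x y ∧
      ∀ z, Relation.EqvGen.setoid (fun u v => v = a u ∨ v = b u) x z → b z = z →
        z = x ∨ z = y := by
  set R := Relation.EqvGen.setoid (fun u v => v = a u ∨ v = b u) with hR
  have hRa : ∀ z, R z (a z) := fun z => Relation.EqvGen.rel _ _ (Or.inl rfl)
  have hRb : ∀ z, R z (b z) := fun z => Relation.EqvGen.rel _ _ (Or.inr rfl)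
  -- Dihedral argument: `b` inverts `ρ` and fixes `x`, so both involutions act on the points `ρ ^ k
  -- x` by reflecting the exponent, `k ↦ -k` for `b` and `k ↦ 1 - k` for `a`.
  set ρ := a * b with hρ
  have haa : a * a = 1 := Equiv.ext ha
  have hbb : b * b = 1 := Equiv.ext hb
  have hconj : b * ρ * b⁻¹ = ρ⁻¹ := by
    rw [eq_inv_iff_mul_eq_one, hρ]
    have h1 : b⁻¹ = b := inv_eq_of_mul_eq_one_left hbb
    rw [h1]
    calc b * (a * b) * b * (a * b) = b * a * (b * b) * a * b := by group
      _ = b * (a * a) * b := by rw [hbb]; group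
      _ = 1 := by rw [haa]; simpa using hbb
  have hbρ : ∀ k : ℤ, b ((ρ ^ k) x) = (ρ ^ (-k)) x := by
    intro k
    have : b * ρ ^ k * b⁻¹ = ρ ^ (-k) := by rw [← conj_zpow, hconj, inv_zpow']
    rw [← this]
    have h1 : b⁻¹ x = x := by rw [Equiv.Perm.inv_eq_iff_eq, hx]
    rw [Equiv.Perm.mul_apply, Equiv.Perm.mul_apply, h1]
  have haρ : ∀ k : ℤ, a ((ρ ^ k) x) = (ρ ^ (1 - k)) x := by
    intro k
    have h1 : a = ρ * b := by rw [hρ, mul_assoc, hbb, mul_one]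
    rw [h1, Equiv.Perm.mul_apply, hbρ, sub_eq_add_neg, zpow_add, zpow_one]
    exact (Equiv.Perm.mul_apply _ _ _).symm
  have horb : ∀ z, R x z → ∃ k : ℤ, z = (ρ ^ k) x := by
    -- Being a power of `ρ` applied to `x` is treated as a map to `Prop`; it suffices that it does
    -- not change along one step.
    have hle : R ≤ Setoid.ker (fun z => ∃ k : ℤ, z = (ρ ^ k) x) := by
      refine Setoid.eqvGen_le ?_
      rintro u v (rfl | rfl)
      · refine propext ⟨?_, ?_⟩
        · rintro ⟨k, rfl⟩
          exact ⟨_, haρ k⟩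
        · rintro ⟨k, hk⟩
          exact ⟨1 - k, by rw [← haρ, ← hk, ha]⟩
      · refine propext ⟨?_, ?_⟩
        · rintro ⟨k, rfl⟩
          exact ⟨_, hbρ k⟩
        · rintro ⟨k, hk⟩
          exact ⟨-k, by rw [← hbρ, ← hk, hb]⟩
    intro z hz
    have h : (∃ k : ℤ, x = (ρ ^ k) x) = ∃ k : ℤ, z = (ρ ^ k) x := hle hz
    rw [← h]
    exact ⟨0, by simp⟩
  have hRρ : ∀ m : ℕ, R x ((ρ ^ m) x) := by
    intro m
    induction m with
    | zero => exact R.refl _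
    | succ m ih =>
      rw [pow_succ']
      exact R.trans ih (R.trans (hRb _) (hRa _))
  set n := Function.minimalPeriod (ρ • ·) x with hn
  have hdvd : ∀ k : ℤ, (ρ ^ k) x = x ↔ (n : ℤ) ∣ k := fun k =>
    MulAction.zpow_smul_eq_iff_minimalPeriod_dvd (a := ρ) (b := x)
  have hdvd' : ∀ k l : ℤ, (ρ ^ k) x = (ρ ^ l) x ↔ (n : ℤ) ∣ k - l := by
    intro k l
    rw [← hdvd, sub_eq_neg_add, zpow_add, Equiv.Perm.mul_apply, zpow_neg,
      Equiv.Perm.inv_eq_iff_eq]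
  have hpos : 0 < n := by
    have hfin : IsOfFinOrder ρ := isOfFinOrder_of_finite ρ
    have h1 := (hdvd (orderOf ρ)).1 (by rw [zpow_natCast, pow_orderOf_eq_one]; rfl)
    have h2 := hfin.orderOf_pos
    exact Nat.pos_of_dvd_of_pos (Int.natCast_dvd_natCast.1 h1) h2
  -- With `n` the length of the `ρ`-cycle of `x`, the point `ρ ^ k x` is fixed by `b` iff `n ∣ 2 *
  -- k`. For `n = 2 * m` this leaves the exponents `0` and `m` modulo `n`.
  rcases Nat.even_or_odd' n with ⟨m, hm | hm⟩
  · refine ⟨(ρ ^ (m : ℤ)) x, ?_, ?_, ?_, ?_⟩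
    · rw [Ne, hdvd]
      intro h
      have := Nat.le_of_dvd (by omega) (Int.natCast_dvd_natCast.1 h)
      omega
    · rw [hbρ, hdvd', hm]
      exact ⟨-1, by push_cast; ring⟩
    · rw [zpow_natCast]; exact hRρ m
    · intro z hz hbz
      obtain ⟨k, rfl⟩ := horb z hz
      rw [hbρ, hdvd', hm] at hbz
      obtain ⟨j, hj⟩ := hbz
      have hk : k = -(m * j) := by push_cast at hj; linarith
      rcases Int.even_or_odd' j with ⟨i, rfl | rfl⟩
      · left
        rw [hdvd, hm]
        exact ⟨-i, by rw [hk]; push_cast; ring⟩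
      · right
        rw [hdvd', hm]
        exact ⟨-i - 1, by rw [hk]; push_cast; ring⟩
  · exfalso
    -- For `n = 2 * m + 1` the reflection `k ↦ 1 - k` fixes `m + 1` modulo `n`, which would be a
    -- fixed point of `a`.
    refine hne ((ρ ^ ((m : ℤ) + 1)) x) ?_
    rw [haρ, hdvd', hm]
    exact ⟨-1, by push_cast; ring⟩

/-! ### Paths outside an edge, and vertex counts -/

namespace ArrowPresentation

variable {X Y E F : Type*}

/-- Two points are equivalent if they are joined by a path that avoids the arrows of `e`. -/
def outer (G : ArrowPresentation X E) (e : E) : Setoid X :=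
  Relation.EqvGen.setoid (fun x y => y = G.gap x ∨ ((∀ i s, x ≠ G.pt e i s) ∧ y = G.seg x))

/-- Letting a path turn back at the ends of `e` makes `outer` the orbit relation of two involutions,
`gap` without fixed points and `b` with exactly the four ends as fixed points. This is the setting
of `Equiv.Perm.exists_unique_other_fixed`. -/
theorem outer_eq (G : ArrowPresentation X E) {e : E} (he : e ∈ G.edges) :
    ∃ b : Equiv.Perm X, (∀ x, b (b x) = x) ∧ (∀ x, b x = x ↔ ∃ i s, x = G.pt e i s) ∧
      G.outer e = Relation.EqvGen.setoid (fun x y => y = G.gap x ∨ y = b x) := by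
  have hinv : ∀ x, (¬ ∃ i s, x = G.pt e i s) → ¬ ∃ i s, G.seg x = G.pt e i s := by
    rintro x hx ⟨i, s, h⟩
    exact hx ⟨i, !s, by rw [← G.seg_pt' he, ← h, G.seg_seg]⟩
  obtain ⟨b, hpos, hneg⟩ : ∃ b : Equiv.Perm X, (∀ x, (∃ i s, x = G.pt e i s) → b x = x) ∧
      ∀ x, (¬ ∃ i s, x = G.pt e i s) → b x = G.seg x := by
    classical
    refine ⟨Function.Involutive.toPerm (fun x => if ∃ i s, x = G.pt e i s then x else G.seg x)
      fun x => ?_, fun x hx => if_pos hx, fun x hx => if_neg hx⟩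
    by_cases hx : ∃ i s, x = G.pt e i s
    · simp only [if_pos hx]
    · simp only [if_neg hx, if_neg (hinv x hx), G.seg_seg]
  refine ⟨b, fun x => ?_, fun x => ?_, ?_⟩
  · by_cases hx : ∃ i s, x = G.pt e i s
    · rw [hpos x hx, hpos x hx]
    · rw [hneg x hx, hneg _ (hinv x hx), G.seg_seg]
  · by_cases hx : ∃ i s, x = G.pt e i s
    · simp only [hpos x hx, hx]
    · simpa only [hneg x hx, hx, iff_false] using G.seg_ne x
  · apply le_antisymm <;> refine Setoid.eqvGen_le ?_
    · rintro x y (rfl | ⟨hx, rfl⟩)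
      · exact Relation.EqvGen.rel _ _ (Or.inl rfl)
      · exact Relation.EqvGen.rel _ _ (Or.inr (hneg x (by push Not; exact hx)).symm)
    · rintro x y (rfl | rfl)
      · exact Relation.EqvGen.rel _ _ (Or.inl rfl)
      · by_cases hx : ∃ i s, x = G.pt e i s
        · rw [hpos x hx]
        · rw [hneg x hx]
          push Not at hx
          exact Relation.EqvGen.rel _ _ (Or.inr ⟨hx, rfl⟩)

/-- Each of the four ends of the arrows of `e` is joined outside `e` to exactly one other end. -/
theorem exists_outer_pt [Finite X] (G : ArrowPresentation X E) {e : E} (he : e ∈ G.edges)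
    (i s : Bool) : ∃ j t, ¬ (j = i ∧ t = s) ∧ G.outer e (G.pt e i s) (G.pt e j t) ∧
      ∀ k u, G.outer e (G.pt e i s) (G.pt e k u) → (k = i ∧ u = s) ∨ (k = j ∧ u = t) := by
  obtain ⟨b, hb, hfix, heq⟩ := G.outer_eq he
  obtain ⟨y, hne, hy, hR, hall⟩ := Equiv.Perm.exists_unique_other_fixed G.gap b G.gap_gap hb
    G.gap_ne ((hfix (G.pt e i s)).2 ⟨i, s, rfl⟩)
  obtain ⟨j, t, rfl⟩ := (hfix y).1 hy
  rw [heq]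
  refine ⟨j, t, fun h => hne ((G.pt_inj_iff he _ _ _ _).2 h), hR, fun k u h => ?_⟩
  rcases hall _ h ((hfix _).2 ⟨k, u, rfl⟩) with h' | h'
  · exact Or.inl ((G.pt_inj_iff he _ _ _ _).1 h')
  · exact Or.inr ((G.pt_inj_iff he _ _ _ _).1 h')

/-- `r` pairs the ends of two arrows `p₁p₂`, `q₁q₂` as `p₁ p₂ | q₁ q₂` (for `k = 0`), as
`p₁ q₂ | p₂ q₁` (for `k = 1`) or as `p₁ q₁ | p₂ q₂` (for `k = 2`). -/
def Pairs (r : Setoid X) (p : Bool → Bool → X) (k : Fin 3) : Prop :=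
  (∀ s, r (p false s) (p true s) ↔ k = 2) ∧ (∀ s, r (p false s) (p true (!s)) ↔ k = 1) ∧
    ∀ i, r (p i false) (p i true) ↔ k = 0

/-- Every end has exactly one partner, so `outer` induces a perfect matching of four points, and
there are only three of these. -/
theorem exists_pairs [Finite X] (G : ArrowPresentation X E) {e : E} (he : e ∈ G.edges) :
    ∃ k, Pairs (G.outer e) (G.pt e) k := by
  have h := G.exists_outer_pt he
  have hs : ∀ x y, G.outer e x y → G.outer e y x := fun _ _ h => Setoid.symm' _ h
  set r := G.outer e
  set p := G.pt e
  obtain ⟨j1, t1, n1, r1, u1⟩ := h false false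
  obtain ⟨j2, t2, n2, r2, u2⟩ := h false true
  obtain ⟨j3, t3, n3, r3, u3⟩ := h true false
  obtain ⟨j4, t4, n4, r4, u4⟩ := h true true
  have e1 := u1 true false
  have e2 := u1 true true
  have e3 := u1 false true
  have f1 := u2 true false
  have f2 := u2 true true
  have f3 := u2 false false
  have g1 := u3 true true
  have g2 := u3 false true
  have g3 := u3 false false
  have k1 := u4 true false
  have k2 := u4 false true
  have k3 := u4 false false
  simp only [Pairs, Bool.forall_bool, Bool.not_false, Bool.not_true]
  -- Instances of symmetry, so that `simp_all` can compare a pair of ends in either order.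
  have w := hs (p false false) (p false true)
  have w1 := hs (p false false) (p true true)
  have w2 := hs (p false false) (p true false)
  have w3 := hs (p false true) (p true true)
  have w4 := hs (p false true) (p true false)
  have w5 := hs (p true false) (p true true)
  have w0 := hs (p false true) (p false false)
  have w01 := hs (p true true) (p false false)
  have w02 := hs (p true false) (p false false)
  have w03 := hs (p true true) (p false true)
  have w04 := hs (p true false) (p false true)
  have w05 := hs (p true true) (p true false)
  clear u1 u2 u3 u4 h hs
  -- The partner of `p₁` determines the matching: `p₂`, `q₁` and `q₂` give `k = 0`, `2` and `1`, and
  -- `n1` excludes `p₁` itself.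
  cases j1 <;> cases t1 <;> simp at n1 e1 e2 e3
  · refine ⟨0, ?_⟩
    cases j3 <;> cases t3 <;> simp at n3 g1 g2 g3 <;> simp_all
  · refine ⟨2, ?_⟩
    cases j2 <;> cases t2 <;> simp at n2 f1 f2 f3 <;> simp_all
  · refine ⟨1, ?_⟩
    cases j2 <;> cases t2 <;> simp at n2 f1 f2 f3 <;> simp_all

theorem outer_le_vertexSetoid (G : ArrowPresentation X E) (e : E) : G.outer e ≤ G.vertexSetoid := by
  refine Setoid.eqvGen_le ?_
  rintro x y (rfl | ⟨-, rfl⟩)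
  · exact Relation.EqvGen.rel _ _ (Or.inl rfl)
  · exact Relation.EqvGen.rel _ _ (Or.inr rfl)

theorem outer_le_boundarySetoid (G : ArrowPresentation X E) {e : E} (h : G.edges = {e}) :
    G.outer e ≤ G.boundarySetoid := by
  refine Setoid.eqvGen_le ?_
  rintro x y (rfl | ⟨hx, rfl⟩)
  · exact Relation.EqvGen.rel _ _ (Or.inl rfl)
  · refine Relation.EqvGen.rel _ _ (Or.inr (Or.inr ⟨fun a ha => ?_, rfl⟩))
    rw [h, Finset.mem_singleton] at ha
    exact ha ▸ hx

/-- A presentation that differs from `G` only in how the ends of the arrows of `e` are joined. -/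
theorem vertexSetoid_eq_outer_merge (G K : ArrowPresentation X E) {e : E} (hgap : K.gap = G.gap)
    (hseg : ∀ x, (∀ i s, x ≠ G.pt e i s) → K.seg x = G.seg x) {a b c d : X}
    (hab : K.seg a = b) (hcd : K.seg c = d)
    (hall : ∀ i s, G.pt e i s = a ∨ G.pt e i s = b ∨ G.pt e i s = c ∨ G.pt e i s = d) :
    K.vertexSetoid = ((G.outer e).mergeClasses a b).mergeClasses c d := by
  have hba : K.seg b = a := by rw [← hab, K.seg_seg]
  have hdc : K.seg d = c := by rw [← hcd, K.seg_seg]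
  have h1 : ((G.outer e).mergeClasses a b).mergeClasses c d a b :=
    Setoid.le_mergeClasses _ _ _ (Setoid.mergeClasses_rel _ _ _)
  have h2 : ((G.outer e).mergeClasses a b).mergeClasses c d c d := Setoid.mergeClasses_rel _ _ _
  apply le_antisymm
  · refine Setoid.eqvGen_le ?_
    have hle : G.outer e ≤ ((G.outer e).mergeClasses a b).mergeClasses c d :=
      (Setoid.le_mergeClasses _ _ _).trans (Setoid.le_mergeClasses _ _ _)
    rintro x y (rfl | rfl)
    · rw [hgap]
      exact hle (Relation.EqvGen.rel _ _ (Or.inl rfl))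
    · by_cases hx : ∃ i s, x = G.pt e i s
      · obtain ⟨i, s, rfl⟩ := hx
        rcases hall i s with h | h | h | h <;> rw [h]
        · rwa [hab]
        · rw [hba]; exact Setoid.symm' _ h1
        · rwa [hcd]
        · rw [hdc]; exact Setoid.symm' _ h2
      · push Not at hx
        rw [hseg x hx]
        exact hle (Relation.EqvGen.rel _ _ (Or.inr ⟨hx, rfl⟩))
  · refine Setoid.mergeClasses_le (Setoid.mergeClasses_le (Setoid.eqvGen_le ?_) ?_) ?_
    · rintro x y (rfl | ⟨hx, rfl⟩)
      · exact Relation.EqvGen.rel _ _ (Or.inl (by rw [hgap]))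
      · exact Relation.EqvGen.rel _ _ (Or.inr (by rw [hseg x hx]))
    · exact Relation.EqvGen.rel _ _ (Or.inr hab.symm)
    · exact Relation.EqvGen.rel _ _ (Or.inr hcd.symm)

/-- The four ends form two classes. Two joins that follow the pairing change nothing; two joins
along another pairing both connect these classes, and only the first of them costs a class. -/
theorem card_merge_pairs [Finite X] {r : Setoid X} {p : Bool → Bool → X} {k : Fin 3}
    (h : Pairs r p k) :
    Nat.card (Quotient ((r.mergeClasses (p false false) (p false true)).mergeClasses
        (p true false) (p true true))) + (if k = 0 then 0 else 1) = Nat.card (Quotient r) ∧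
    Nat.card (Quotient ((r.mergeClasses (p false false) (p true true)).mergeClasses
        (p false true) (p true false))) + (if k = 1 then 0 else 1) = Nat.card (Quotient r) ∧
    Nat.card (Quotient ((r.mergeClasses (p false false) (p true false)).mergeClasses
        (p false true) (p true true))) + (if k = 2 then 0 else 1) = Nat.card (Quotient r) := by
  classical
  obtain ⟨h1, h2, h3⟩ := h
  have a1 := h1 true
  have a2 := h1 false
  have b1 := h2 true
  have b2 := h2 false
  have c1 := h3 true
  have c2 := h3 false
  simp only [Bool.not_false, Bool.not_true] at b1 b2
  have hr : ∀ u v, r u v ↔ r v u := fun _ _ => r.comm'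
  refine ⟨?_, ?_, ?_⟩
  all_goals
    rw [← Setoid.card_mergeClasses_add r, ← Setoid.card_mergeClasses_add (r.mergeClasses _ _)]
    rw [add_assoc]
    congr 1
    simp only [Setoid.mergeClasses_apply, hr (p true true), hr (p true false) (p false _),
      hr (p false true) (p false false), a1, a2, b1, b2, c1, c2]
    fin_cases k <;> simp

theorem card_vertex_delete [Finite X] (G : ArrowPresentation X E) {e : E} (he : e ∈ G.edges)
    {k : Fin 3} (h : Pairs (G.outer e) (G.pt e) k) :
    Nat.card (G.delete e he).Vertex + (if k = 0 then 0 else 1) =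
      Nat.card (Quotient (G.outer e)) := by
  rw [← (card_merge_pairs h).1, Vertex, G.vertexSetoid_eq_outer_merge (e := e) (G.delete e he) rfl
    (fun x _ => by rw [G.delete_seg]) (a := G.pt e false false) (c := G.pt e true false)
    (by rw [G.delete_seg, G.seg_pt' he]) (by rw [G.delete_seg, G.seg_pt' he])]
  · rfl
  rintro (_ | _) (_ | _) <;> simp

theorem card_vertex_contract [Finite X] (G : ArrowPresentation X E) {e : E} (he : e ∈ G.edges)
    {k : Fin 3} (h : Pairs (G.outer e) (G.pt e) k) :
    Nat.card (G.contract e he).Vertex + (if k = 1 then 0 else 1) =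
      Nat.card (Quotient (G.outer e)) := by
  rw [← (card_merge_pairs h).2.1, Vertex, G.vertexSetoid_eq_outer_merge (G.contract e he) rfl
    (fun x hx => G.rejoin_seg_of_ne he _ _ hx) (G.contract_seg_pt he false false)
    (G.contract_seg_pt he false true)]
  · rfl
  rintro (_ | _) (_ | _) <;> simp

theorem card_vertex_penrose [Finite X] (G : ArrowPresentation X E) {e : E} (he : e ∈ G.edges)
    {k : Fin 3} (h : Pairs (G.outer e) (G.pt e) k) :
    Nat.card (G.penrose e he).Vertex + (if k = 2 then 0 else 1) =
      Nat.card (Quotient (G.outer e)) := by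
  rw [← (card_merge_pairs h).2.2, Vertex, G.vertexSetoid_eq_outer_merge (G.penrose e he) rfl
    (fun x hx => G.rejoin_seg_of_ne he _ _ hx) (G.penrose_seg_pt he false false)
    (G.penrose_seg_pt he false true)]
  · rfl
  rintro (_ | _) (_ | _) <;> simp

/-- The circles of the 2-sum consist of paths outside `f` and outside `e`, linked by the four new
segments. Written as four successive gluings, the partition can be counted. -/
theorem vertexSetoid_twoSum (G : ArrowPresentation X E) (H : ArrowPresentation Y F)
    (f : E) (hf : f ∈ G.edges) (e : F) (he : e ∈ H.edges) (φ : Bool ≃ Bool) :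
    (G.twoSum H f hf e he φ).vertexSetoid =
      (((((G.outer f).disjUnion (H.outer e)).mergeClasses
        (Sum.inl (G.pt f false false)) (Sum.inr (H.pt e (φ false) false))).mergeClasses
        (Sum.inl (G.pt f false true)) (Sum.inr (H.pt e (φ false) true))).mergeClasses
        (Sum.inl (G.pt f true false)) (Sum.inr (H.pt e (φ true) false))).mergeClasses
        (Sum.inl (G.pt f true true)) (Sum.inr (H.pt e (φ true) true)) := by
  apply le_antisymm
  · set R := Setoid.mergeClasses _ (Sum.inl (G.pt f true true)) (Sum.inr (H.pt e (φ true) true))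
      with hR
    have h1 : ∀ i s, R (Sum.inl (G.pt f i s)) (Sum.inr (H.pt e (φ i) s)) := by
      rintro (_ | _) (_ | _)
      · exact Setoid.le_mergeClasses _ _ _ (Setoid.le_mergeClasses _ _ _
          (Setoid.le_mergeClasses _ _ _ (Setoid.mergeClasses_rel _ _ _)))
      · exact Setoid.le_mergeClasses _ _ _ (Setoid.le_mergeClasses _ _ _
          (Setoid.mergeClasses_rel _ _ _))
      · exact Setoid.le_mergeClasses _ _ _ (Setoid.mergeClasses_rel _ _ _)
      · exact Setoid.mergeClasses_rel _ _ _
    have hle : (G.outer f).disjUnion (H.outer e) ≤ R :=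
      (Setoid.le_mergeClasses _ _ _).trans ((Setoid.le_mergeClasses _ _ _).trans
        ((Setoid.le_mergeClasses _ _ _).trans (Setoid.le_mergeClasses _ _ _)))
    refine Setoid.eqvGen_le ?_
    rintro (x | y) z (rfl | rfl)
    · exact hle (Sum.LiftRel.inl (Relation.EqvGen.rel _ _ (Or.inl rfl)))
    · by_cases hx : ∃ i s, x = G.pt f i s
      · obtain ⟨i, s, rfl⟩ := hx
        rw [twoSum_seg_inl_pt]
        exact h1 i s
      · push Not at hx
        rw [twoSum_seg_inl _ _ _ _ _ _ _ hx]
        exact hle (Sum.LiftRel.inl (Relation.EqvGen.rel _ _ (Or.inr ⟨hx, rfl⟩)))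
    · exact hle (Sum.LiftRel.inr (Relation.EqvGen.rel _ _ (Or.inl rfl)))
    · by_cases hy : ∃ i s, y = H.pt e i s
      · obtain ⟨i, s, rfl⟩ := hy
        obtain ⟨i, rfl⟩ := φ.surjective i
        rw [twoSum_seg_inr_pt]
        exact Setoid.symm' _ (h1 i s)
      · push Not at hy
        rw [twoSum_seg_inr _ _ _ _ _ _ _ hy]
        exact hle (Sum.LiftRel.inr (Relation.EqvGen.rel _ _ (Or.inr ⟨hy, rfl⟩)))
  · have h1 : ∀ i s, (G.twoSum H f hf e he φ).vertexSetoid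
        (Sum.inl (G.pt f i s)) (Sum.inr (H.pt e (φ i) s)) := fun i s =>
      Relation.EqvGen.rel _ _ (Or.inr (G.twoSum_seg_inl_pt H f hf e he φ i s).symm)
    refine Setoid.mergeClasses_le (Setoid.mergeClasses_le (Setoid.mergeClasses_le
      (Setoid.mergeClasses_le (Setoid.disjUnion_le ?_ ?_) (h1 _ _)) (h1 _ _)) (h1 _ _)) (h1 _ _)
    · have : G.outer f ≤ Setoid.comap Sum.inl (G.twoSum H f hf e he φ).vertexSetoid := by
        refine Setoid.eqvGen_le ?_
        rintro x y (rfl | ⟨hx, rfl⟩)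
        · exact Relation.EqvGen.rel _ _ (Or.inl rfl)
        · exact Relation.EqvGen.rel _ _ (Or.inr (G.twoSum_seg_inl H f hf e he φ hx).symm)
      exact fun x x' h => this h
    · have : H.outer e ≤ Setoid.comap Sum.inr (G.twoSum H f hf e he φ).vertexSetoid := by
        refine Setoid.eqvGen_le ?_
        rintro x y (rfl | ⟨hx, rfl⟩)
        · exact Relation.EqvGen.rel _ _ (Or.inl rfl)
        · exact Relation.EqvGen.rel _ _ (Or.inr (G.twoSum_seg_inr H f hf e he φ hx).symm)
      exact fun x x' h => this h

/-- Exchanging the two arrows maps each of the three pairings to itself, so the coupling has no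
influence on the vertex count. -/
theorem Pairs.comp_equiv {r : Setoid X} {p : Bool → Bool → X} {k : Fin 3} (h : Pairs r p k)
    (φ : Bool ≃ Bool) : Pairs r (fun i => p (φ i)) k := by
  obtain ⟨h1, h2, h3⟩ := h
  have hc : φ true = !(φ false) := by
    have : φ true ≠ φ false := fun h => by simpa using φ.injective h
    revert this
    cases φ true <;> cases φ false <;> simp
  refine ⟨fun s => ?_, fun s => ?_, fun i => h3 _⟩
  · simp only [hc]
    cases φ false
    · exact h1 s
    · rw [r.comm']; exact h1 s
  · simp only [hc]
    cases φ false
    · exact h2 s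
    · rw [r.comm', ← h2 (!s), Bool.not_not]; rfl

/-- The ends form two classes on either side, linked by four gluings. If the pairings agree, the
links form two separate 2-cycles and four classes become two; otherwise they form one 4-cycle and
four classes become one. -/
theorem card_glue_pairs [Finite X] [Finite Y] {r : Setoid X} {s : Setoid Y}
    {p : Bool → Bool → X} {q : Bool → Bool → Y} {k l : Fin 3} (h : Pairs r p k)
    (h' : Pairs s q l) :
    Nat.card (Quotient (((((r.disjUnion s).mergeClasses
        (Sum.inl (p false false)) (Sum.inr (q false false))).mergeClasses
        (Sum.inl (p false true)) (Sum.inr (q false true))).mergeClasses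
        (Sum.inl (p true false)) (Sum.inr (q true false))).mergeClasses
        (Sum.inl (p true true)) (Sum.inr (q true true)))) + (if k = l then 2 else 3) =
      Nat.card (Quotient r) + Nat.card (Quotient s) := by
  classical
  obtain ⟨h1, h2, h3⟩ := h
  have a1 := h1 true
  have a2 := h1 false
  have b1 := h2 true
  have b2 := h2 false
  have c1 := h3 true
  have c2 := h3 false
  obtain ⟨h1, h2, h3⟩ := h'
  have a1' := h1 true
  have a2' := h1 false
  have b1' := h2 true
  have b2' := h2 false
  have c1' := h3 true
  have c2' := h3 false
  simp only [Bool.not_false, Bool.not_true] at b1 b2 b1' b2'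
  have hr : ∀ u v, r u v ↔ r v u := fun _ _ => r.comm'
  have hs : ∀ u v, s u v ↔ s v u := fun _ _ => s.comm'
  -- Each gluing lowers the count by one unless its two points are already related, so the total
  -- drop is a sum of four indicators, all decided by `k` and `l`.
  rw [← Setoid.card_disjUnion,
    ← Setoid.card_mergeClasses_add (r.disjUnion s) (Sum.inl (p false false))
      (Sum.inr (q false false)),
    ← Setoid.card_mergeClasses_add ((r.disjUnion s).mergeClasses _ _) (Sum.inl (p false true))
      (Sum.inr (q false true)),
    ← Setoid.card_mergeClasses_add (((r.disjUnion s).mergeClasses _ _).mergeClasses _ _)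
      (Sum.inl (p true false)) (Sum.inr (q true false)),
    ← Setoid.card_mergeClasses_add
      ((((r.disjUnion s).mergeClasses _ _).mergeClasses _ _).mergeClasses _ _)
      (Sum.inl (p true true)) (Sum.inr (q true true)), add_assoc, add_assoc, add_assoc]
  congr 1
  simp only [Setoid.mergeClasses_apply, Setoid.disjUnion_inl_inl, Setoid.disjUnion_inr_inr,
    Setoid.not_disjUnion_inl_inr, Setoid.not_disjUnion_inr_inl,
    hr (p true true), hr (p true false) (p false _),
    hr (p false true) (p false false), hs (q true true),
    hs (q true false) (q false _), hs (q false true) (q false false),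
    a1, a2, b1, b2, c1, c2, a1', a2', b1', b2', c1', c2']
  fin_cases k <;> fin_cases l <;> simp

/-- Compared with `card_vertex_delete` and its two analogues on `G`, this says that the 2-sum has as
many vertices as the operation of type `l` at `f` leaves, plus the number of outer classes of `H`
minus two. -/
theorem card_vertex_twoSum [Finite X] [Finite Y] (G : ArrowPresentation X E)
    (H : ArrowPresentation Y F) (f : E) (hf : f ∈ G.edges) (e : F) (he : e ∈ H.edges)
    (φ : Bool ≃ Bool) {k l : Fin 3} (h : Pairs (G.outer f) (G.pt f) k)
    (h' : Pairs (H.outer e) (H.pt e) l) :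
    Nat.card (G.twoSum H f hf e he φ).Vertex + (if k = l then 2 else 3) =
      Nat.card (Quotient (G.outer f)) + Nat.card (Quotient (H.outer e)) := by
  have h1 := card_glue_pairs h (h'.comp_equiv φ)
  have h2 := congrArg (fun r : Setoid (X ⊕ Y) => Nat.card (Quotient r))
    (G.vertexSetoid_twoSum H f hf e he φ)
  rw [← h1]
  exact congrArg (· + if k = l then 2 else 3) h2

end ArrowPresentation

/-! ### Operations at other edges commute with the 2-sum -/

theorem Equiv.Perm.sumCongr_swap_conj_left {X Y : Type*} [DecidableEq X] [DecidableEq (X ⊕ Y)]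
    (σ : Equiv.Perm X) (τ : Equiv.Perm Y) (a b : X) :
    Equiv.sumCongr (Equiv.swap a b * σ * Equiv.swap a b) τ =
      Equiv.swap (Sum.inl a) (Sum.inl b) * Equiv.sumCongr σ τ *
        Equiv.swap (Sum.inl a) (Sum.inl b) := by
  have h : ∀ x : X, Equiv.swap (Sum.inl a : X ⊕ Y) (Sum.inl b) (Sum.inl x) =
      Sum.inl (Equiv.swap a b x) := fun x => by
    simp only [Equiv.swap_apply_def, Sum.inl.injEq]
    split_ifs <;> rfl
  ext (x | y)
  · simp [h]
  · simp [Equiv.swap_apply_def]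

theorem Equiv.Perm.sumCongr_swap_conj_right {X Y : Type*} [DecidableEq Y] [DecidableEq (X ⊕ Y)]
    (σ : Equiv.Perm X) (τ : Equiv.Perm Y) (a b : Y) :
    Equiv.sumCongr σ (Equiv.swap a b * τ * Equiv.swap a b) =
      Equiv.swap (Sum.inr a) (Sum.inr b) * Equiv.sumCongr σ τ *
        Equiv.swap (Sum.inr a) (Sum.inr b) := by
  have h : ∀ x : Y, Equiv.swap (Sum.inr a : X ⊕ Y) (Sum.inr b) (Sum.inr x) =
      Sum.inr (Equiv.swap a b x) := fun x => by
    simp only [Equiv.swap_apply_def, Sum.inr.injEq]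
    split_ifs <;> rfl
  ext (x | y)
  · simp [Equiv.swap_apply_def]
  · simp [h]

namespace PackagedArrowPresentation

variable {X Y E F : Type*}

/-- The transposition of an operation is disjoint from those of the 2-sum and can be moved past
them. The decidability instances are explicit because the operation and the 2-sum bring their own.
-/
theorem swap_conj_twoSum_left (d : DecidableEq X) (d1 d2 : DecidableEq (X ⊕ Y))
    (σ : Equiv.Perm X) (τ : Equiv.Perm Y) {a b p q : X} (p' q' : Y) (h1 : p ≠ a) (h2 : p ≠ b)
    (h3 : q ≠ a) (h4 : q ≠ b) :
    @Equiv.swap _ d1 (Sum.inl a) (Sum.inl b) *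
      (@Equiv.swap _ d2 (Sum.inl q) (Sum.inr q') * (@Equiv.swap _ d2 (Sum.inl p) (Sum.inr p') *
        Equiv.sumCongr σ τ * @Equiv.swap _ d2 (Sum.inl p) (Sum.inr p')) *
        @Equiv.swap _ d2 (Sum.inl q) (Sum.inr q')) * @Equiv.swap _ d1 (Sum.inl a) (Sum.inl b) =
    @Equiv.swap _ d2 (Sum.inl q) (Sum.inr q') * (@Equiv.swap _ d2 (Sum.inl p) (Sum.inr p') *
        Equiv.sumCongr (Equiv.swap a b * σ * Equiv.swap a b) τ *
        @Equiv.swap _ d2 (Sum.inl p) (Sum.inr p')) * @Equiv.swap _ d2 (Sum.inl q) (Sum.inr q') := by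
  obtain rfl : d1 = d2 := Subsingleton.elim _ _
  rw [swap_conj_comm _ (p := Sum.inl q) (p' := Sum.inl a) (z' := Sum.inl b) (by simpa using h3)
      (by simpa using h4) (by simp) (by simp),
    swap_conj_comm _ (p := Sum.inl p) (p' := Sum.inl a) (z' := Sum.inl b) (by simpa using h1)
      (by simpa using h2) (by simp) (by simp),
    Equiv.Perm.sumCongr_swap_conj_left]

theorem swap_conj_twoSum_right (d : DecidableEq Y) (d1 d2 : DecidableEq (X ⊕ Y))
    (σ : Equiv.Perm X) (τ : Equiv.Perm Y) {a b p' q' : Y} (p q : X) (h1 : p' ≠ a) (h2 : p' ≠ b)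
    (h3 : q' ≠ a) (h4 : q' ≠ b) :
    @Equiv.swap _ d1 (Sum.inr a) (Sum.inr b) *
      (@Equiv.swap _ d2 (Sum.inl q) (Sum.inr q') * (@Equiv.swap _ d2 (Sum.inl p) (Sum.inr p') *
        Equiv.sumCongr σ τ * @Equiv.swap _ d2 (Sum.inl p) (Sum.inr p')) *
        @Equiv.swap _ d2 (Sum.inl q) (Sum.inr q')) * @Equiv.swap _ d1 (Sum.inr a) (Sum.inr b) =
    @Equiv.swap _ d2 (Sum.inl q) (Sum.inr q') * (@Equiv.swap _ d2 (Sum.inl p) (Sum.inr p') *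
        Equiv.sumCongr σ (Equiv.swap a b * τ * Equiv.swap a b) *
        @Equiv.swap _ d2 (Sum.inl p) (Sum.inr p')) * @Equiv.swap _ d2 (Sum.inl q) (Sum.inr q') := by
  obtain rfl : d1 = d2 := Subsingleton.elim _ _
  rw [swap_conj_comm _ (p := Sum.inl q) (p' := Sum.inr a) (z' := Sum.inr b) (by simp) (by simp)
      (by simpa using h3) (by simpa using h4),
    swap_conj_comm _ (p := Sum.inl p) (p' := Sum.inr a) (z' := Sum.inr b) (by simp) (by simp)
      (by simpa using h1) (by simpa using h2),
    Equiv.Perm.sumCongr_swap_conj_right]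

theorem merge_glue_left (r : Setoid X) (s : Setoid Y) (a b p q : X) (p' q' : Y) :
    (((r.disjUnion s).mergeClasses (Sum.inl p) (Sum.inr p')).mergeClasses
      (Sum.inl q) (Sum.inr q')).mergeClasses (Sum.inl a) (Sum.inl b) =
    (((r.mergeClasses a b).disjUnion s).mergeClasses (Sum.inl p) (Sum.inr p')).mergeClasses
      (Sum.inl q) (Sum.inr q') := by
  rw [Setoid.disjUnion_mergeClasses_left, Setoid.mergeClasses_right_comm _ (Sum.inl q),
    Setoid.mergeClasses_right_comm _ (Sum.inl p)]

theorem merge_glue_right (r : Setoid X) (s : Setoid Y) (a b p' q' : Y) (p q : X) :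
    (((r.disjUnion s).mergeClasses (Sum.inl p) (Sum.inr p')).mergeClasses
      (Sum.inl q) (Sum.inr q')).mergeClasses (Sum.inr a) (Sum.inr b) =
    ((r.disjUnion (s.mergeClasses a b)).mergeClasses (Sum.inl p) (Sum.inr p')).mergeClasses
      (Sum.inl q) (Sum.inr q') := by
  rw [Setoid.disjUnion_mergeClasses_right, Setoid.mergeClasses_right_comm _ (Sum.inl q),
    Setoid.mergeClasses_right_comm _ (Sum.inl p)]

theorem op_twoSum_inl (k : Fin 5) (G : PackagedArrowPresentation X E)
    (H : PackagedArrowPresentation Y F) (f : E) (hf : f ∈ G.edges) (e : F) (he : e ∈ H.edges)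
    (φ : Bool ≃ Bool) (g : E) (hg : g ∈ G.edges)
    (hg' : Sum.inl g ∈ (G.twoSum H f hf e he φ).edges) (hf' : f ∈ (op k G g hg).edges) :
    op k (G.twoSum H f hf e he φ) (Sum.inl g) hg' = (op k G g hg).twoSum H f hf' e he φ := by
  classical
  have hne : f ≠ g := by
    rw [op_edges] at hf'
    exact Finset.ne_of_mem_erase hf'
  have key : ∀ i s j t, G.pt f i s ≠ G.pt g j t := fun i s j t h =>
    hne (G.pt_inj f hf g hg _ _ _ _ h).1
  fin_cases k <;>
  · apply PackagedArrowPresentation.ext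
    · rfl
    · exact swap_conj_twoSum_left _ _ _ _ _ _ _ (key _ _ _ _) (key _ _ _ _) (key _ _ _ _)
        (key _ _ _ _)
    · ext (a | a) <;>
        simp [op, delete, contract, penrose, mergeDelete, mergeContract, twoSum,
          ArrowPresentation.delete, ArrowPresentation.contract, ArrowPresentation.penrose,
          ArrowPresentation.rejoin, ArrowPresentation.twoSum, and_left_comm]
    · rfl
    · first | rfl | exact merge_glue_left _ _ _ _ _ _ _ _
    · first | rfl | exact merge_glue_left _ _ _ _ _ _ _ _

theorem op_twoSum_inr (k : Fin 5) (G : PackagedArrowPresentation X E)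
    (H : PackagedArrowPresentation Y F) (f : E) (hf : f ∈ G.edges) (e : F) (he : e ∈ H.edges)
    (φ : Bool ≃ Bool) (g : F) (hg : g ∈ H.edges)
    (hg' : Sum.inr g ∈ (G.twoSum H f hf e he φ).edges) (he' : e ∈ (op k H g hg).edges) :
    op k (G.twoSum H f hf e he φ) (Sum.inr g) hg' = G.twoSum (op k H g hg) f hf e he' φ := by
  classical
  have hne : e ≠ g := by
    rw [op_edges] at he'
    exact Finset.ne_of_mem_erase he'
  have key : ∀ i s j t, H.pt e i s ≠ H.pt g j t := fun i s j t h =>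
    hne (H.pt_inj e he g hg _ _ _ _ h).1
  fin_cases k <;>
  · apply PackagedArrowPresentation.ext
    · rfl
    · exact swap_conj_twoSum_right _ _ _ _ _ _ _ (key _ _ _ _) (key _ _ _ _) (key _ _ _ _)
        (key _ _ _ _)
    · ext (a | a) <;>
        simp [op, delete, contract, penrose, mergeDelete, mergeContract, twoSum,
          ArrowPresentation.delete, ArrowPresentation.contract, ArrowPresentation.penrose,
          ArrowPresentation.rejoin, ArrowPresentation.twoSum, and_left_comm]
    · rfl
    · first | rfl | exact merge_glue_right _ _ _ _ _ _ _ _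
    · first | rfl | exact merge_glue_right _ _ _ _ _ _ _ _

theorem Q_eq_sum (G : PackagedArrowPresentation X E) (e : E) (he : e ∈ G.edges) :
    Q G = ∑ k, MvPolynomial.X (opVar k) * Q (op k G e he) := by
  rw [isQ_Q.1 G e he]
  simp [Fin.sum_univ_five, op, opVar]

theorem qVec_apply (G : PackagedArrowPresentation X E) (e : E) (he : e ∈ G.edges) (k : Fin 5) :
    G.qVec e he k = Q (op k G e he) := by
  fin_cases k <;> rfl

end PackagedArrowPresentation

/-! ### Uniqueness of the solution -/

theorem systemMatrix_det_ne_zero : systemMatrix.det ≠ 0 := by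
  intro h
  -- Subtracting row 4 from row 1 and row 5 from row 2 shows that the determinant is `(αβγ)^5 α² (β
  -- - 1) (γ - 1) (α - 1)² (α + 2)`. It does not vanish when every variable is `2`; the values `0`
  -- and `1` would not do.
  have h1 := congrArg (MvPolynomial.eval (fun _ : QVar => (2 : ℤ))) h
  rw [RingHom.map_det, map_zero] at h1
  have h2 : (MvPolynomial.eval (fun _ : QVar => (2 : ℤ))).mapMatrix systemMatrix =
      (8 : ℤ) • !![4, 1, 1, 2, 1; 1, 4, 1, 1, 2; 1, 1, 2, 1, 1; 2, 1, 1, 2, 1; 1, 2, 1, 1, 2] := by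
    ext i j
    fin_cases i <;> fin_cases j <;> simp [systemMatrix]
  rw [h2, Matrix.det_smul] at h1
  revert h1
  simp [Matrix.det_succ_row_zero, Fin.sum_univ_succ, Fin.succAbove]

/-- A solution over `QRing` is supplied as a hypothesis, so the determinant enters only through
injectivity and no denominators have to be cleared. -/
theorem systemMatrix_map_mulVec_eq_iff {v ϕ : Fin 5 → QRing} (h : systemMatrix *ᵥ ϕ = v)
    (ψ : Fin 5 → FractionRing QRing) :
    systemMatrix.map (algebraMap QRing (FractionRing QRing)) *ᵥ ψ =
      algebraMap QRing (FractionRing QRing) ∘ v ↔ ψ = algebraMap QRing (FractionRing QRing) ∘ ϕ := by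
  have h1 : algebraMap QRing (FractionRing QRing) ∘ v =
      systemMatrix.map (algebraMap QRing (FractionRing QRing)) *ᵥ
        (algebraMap QRing (FractionRing QRing) ∘ ϕ) := by
    rw [← h]
    ext i
    exact RingHom.map_mulVec _ _ _ _
  rw [h1]
  refine (Matrix.mulVec_injective_of_isUnit ?_).eq_iff
  rw [Matrix.isUnit_iff_isUnit_det, isUnit_iff_ne_zero]
  change ((algebraMap QRing (FractionRing QRing)).mapMatrix systemMatrix).det ≠ 0
  rw [← RingHom.map_det]
  exact (map_ne_zero_iff _ (IsFractionRing.injective QRing (FractionRing QRing))).2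
    systemMatrix_det_ne_zero

/-! ### Presentations with a single edge -/

namespace PackagedArrowPresentation

variable {X Y E F : Type*}

theorem edgelessValue_eq (G : PackagedArrowPresentation X E) {n m k : ℕ}
    (hn : Nat.card G.Vertex = n) (hm : Nat.card (Quotient G.vpart) = m)
    (hk : Nat.card (Quotient G.bpart) = k) :
    G.edgelessValue =
      MvPolynomial.X QVar.α ^ n * MvPolynomial.X QVar.β ^ m * MvPolynomial.X QVar.γ ^ k := by
  rw [edgelessValue, hn, hm, hk]

theorem exists_card_mergeClasses [Finite X] (r : Setoid X) (x y : X) :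
    ∃ m, Nat.card (Quotient (r.mergeClasses x y)) = m + 1 := by
  have : Nonempty (Quotient (r.mergeClasses x y)) := ⟨Quotient.mk _ x⟩
  exact Nat.exists_eq_add_one.2 Nat.card_pos

theorem exists_card_outer [Finite X] (G : ArrowPresentation X E) {e : E} (he : e ∈ G.edges)
    {k : Fin 3} (h : ArrowPresentation.Pairs (G.outer e) (G.pt e) k) :
    ∃ n, Nat.card (Quotient (G.outer e)) = n + 2 := by
  have h1 := G.card_vertex_delete he h
  have h2 := G.card_vertex_contract he h
  have : Nonempty (G.delete e he).Vertex := ⟨Quotient.mk _ (G.pt e false false)⟩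
  have : Nonempty (G.contract e he).Vertex := ⟨Quotient.mk _ (G.pt e false false)⟩
  have : Finite (G.delete e he).Vertex := inferInstanceAs (Finite (Quotient _))
  have : Finite (G.contract e he).Vertex := inferInstanceAs (Finite (Quotient _))
  have h3 : 0 < Nat.card (G.delete e he).Vertex := Nat.card_pos
  have h4 : 0 < Nat.card (G.contract e he).Vertex := Nat.card_pos
  -- Since `k` is not both `0` and `1`, in one of the two counts the outer classes outnumber a
  -- nonempty set of vertices.
  obtain ⟨n, hn⟩ := Nat.exists_eq_add_of_le (show 2 ≤ Nat.card (Quotient (G.outer e)) by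
    fin_cases k <;> simp at h1 h2 <;> omega)
  exact ⟨n, by omega⟩

theorem rel_comp_equiv (r : Setoid X) (p : Bool → X) (φ : Bool ≃ Bool) :
    r (p (φ false)) (p (φ true)) ↔ r (p false) (p true) := by
  have hc : φ true = !(φ false) := by
    have : φ true ≠ φ false := fun h => by simpa using φ.injective h
    revert this
    cases φ true <;> cases φ false <;> simp
  rw [hc]
  cases φ false
  · rfl
  · exact r.comm'

/-- The pairing of the ends of the arrows of `e`, and whether the two arrows lie on one vertex
class and on one boundary class, for a presentation whose only edge is `e`. -/
theorem rel_of_pairs (H : PackagedArrowPresentation Y F) {e : F} (h : H.edges = {e}) {k : Fin 3}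
    (hk : ArrowPresentation.Pairs (H.outer e) (H.pt e) k) :
    (k ≠ 0 → H.vpart (H.pt e false false) (H.pt e true false)) ∧
      (k ≠ 1 → H.bpart (H.pt e false false) (H.pt e true false)) := by
  have he : e ∈ H.edges := by simp [h]
  obtain ⟨h1, h2, h3⟩ := hk
  have hv : ∀ {x y}, H.outer e x y → H.vpart x y := fun h' =>
    H.vertex_le (H.outer_le_vertexSetoid e h')
  have hb : ∀ {x y}, H.outer e x y → H.bpart x y := fun h' =>
    H.boundary_le (H.outer_le_boundarySetoid h h')
  have hs : H.vpart (H.pt e true true) (H.pt e true false) := by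
    have := H.vpart_seg (H.pt e true true)
    rwa [H.seg_pt' he] at this
  fin_cases k
  · refine ⟨fun h' => absurd rfl h', fun _ => ?_⟩
    -- An outer path leads from `p₁` to `p₂`, and the boundary curve at `e` from there to `q₁`.
    exact H.bpart.trans (hb ((h3 false).2 rfl)) (H.bpart_pt he false true)
  · refine ⟨fun _ => ?_, fun h' => absurd rfl h'⟩
    -- An outer path leads from `p₁` to `q₂`, and the segment of the second arrow from there to
    -- `q₁`.
    exact H.vpart.trans (hv ((h2 false).2 rfl)) hs
  · exact ⟨fun _ => hv ((h1 false).2 rfl), fun _ => hb ((h1 false).2 rfl)⟩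

/-- A presentation whose only edge is `e` acts in 2-sums as one of the five operations, up to a
monomial factor. -/
theorem exists_op_of_single_edge [Finite Y] (H : PackagedArrowPresentation Y F) {e : F}
    (h : H.edges = {e}) (he : e ∈ H.edges) :
    ∃ (t : Fin 5) (w : QRing), (∀ j, (op j H e he).edgelessValue = w * systemMatrix j t) ∧
      ∀ {X : Type*} {E : Type*} [Finite X] (G : PackagedArrowPresentation X E) (f : E)
        (hf : f ∈ G.edges) (φ : Bool ≃ Bool),
        (G.twoSum H f hf e he φ).edgelessValue = w * (op t G f hf).edgelessValue := by
  classical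
  obtain ⟨k, hk⟩ := H.exists_pairs he
  obtain ⟨n, hn⟩ := exists_card_outer _ he hk
  obtain ⟨hv, hb⟩ := H.rel_of_pairs h hk
  obtain ⟨m, hm⟩ := exists_card_mergeClasses H.vpart (H.pt e false false) (H.pt e true false)
  obtain ⟨l, hl⟩ := exists_card_mergeClasses H.bpart (H.pt e false false) (H.pt e true false)
  have hm' := Setoid.card_mergeClasses_add H.vpart (H.pt e false false) (H.pt e true false)
  have hl' := Setoid.card_mergeClasses_add H.bpart (H.pt e false false) (H.pt e true false)
  rw [hm] at hm'
  rw [hl] at hl'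
  have hd := H.card_vertex_delete he hk
  have hc := H.card_vertex_contract he hk
  have hp := H.card_vertex_penrose he hk
  rw [hn] at hd hc hp
  -- All counts below are at least `n + 1`, `m + 1` and `l + 1`; the excess of one in each exponent
  -- is the factor `αβγ` of the system matrix.
  set W : QRing := MvPolynomial.X QVar.α ^ n * MvPolynomial.X QVar.β ^ m *
    MvPolynomial.X QVar.γ ^ l with hW
  -- the polynomials of the five presentations obtained from `H`
  have hops : ∀ {d c p v b : ℕ}, Nat.card (H.toArrowPresentation.delete e he).Vertex = n + d →
      Nat.card (H.toArrowPresentation.contract e he).Vertex = n + c →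
      Nat.card (H.toArrowPresentation.penrose e he).Vertex = n + p →
      Nat.card (Quotient H.vpart) = m + v → Nat.card (Quotient H.bpart) = l + b →
      ∀ j, (op j H e he).edgelessValue = W *
        (![MvPolynomial.X QVar.α ^ d * MvPolynomial.X QVar.β ^ v * MvPolynomial.X QVar.γ,
          MvPolynomial.X QVar.α ^ c * MvPolynomial.X QVar.β * MvPolynomial.X QVar.γ ^ b,
          MvPolynomial.X QVar.α ^ p * MvPolynomial.X QVar.β * MvPolynomial.X QVar.γ,
          MvPolynomial.X QVar.α ^ d * MvPolynomial.X QVar.β * MvPolynomial.X QVar.γ,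
          MvPolynomial.X QVar.α ^ c * MvPolynomial.X QVar.β * MvPolynomial.X QVar.γ] :
            Fin 5 → QRing) j := by
    intro d c p v b hd hc hp hv hb j
    fin_cases j
    · refine (edgelessValue_eq (H.delete e he) hd hv hl).trans ?_
      simp only [hW, pow_add, pow_one, Fin.zero_eta, Matrix.cons_val]
      ring
    · refine (edgelessValue_eq (H.contract e he) hc hm hb).trans ?_
      simp only [hW, pow_add, pow_one, Fin.mk_one, Matrix.cons_val]
      ring
    · refine (edgelessValue_eq (H.penrose e he) hp hm hl).trans ?_
      simp only [hW, pow_add, pow_one, Fin.reduceFinMk, Matrix.cons_val]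
      ring
    · refine (edgelessValue_eq (H.mergeDelete e he) hd hm hl).trans ?_
      simp only [hW, pow_add, pow_one, Fin.reduceFinMk, Matrix.cons_val]
      ring
    · refine (edgelessValue_eq (H.mergeContract e he) hc hm hl).trans ?_
      simp only [hW, pow_add, pow_one, Fin.reduceFinMk, Matrix.cons_val]
      ring
  -- the polynomial of a 2-sum with `H`
  have hsum : ∀ {X : Type _} {E : Type _} (G : PackagedArrowPresentation X E) (f : E)
      (hf : f ∈ G.edges) (φ : Bool ≃ Bool) (K : PackagedArrowPresentation X E),
      Nat.card (G.twoSum H f hf e he φ).Vertex = n + Nat.card K.Vertex →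
      Nat.card (Quotient (G.twoSum H f hf e he φ).vpart) = m + Nat.card (Quotient K.vpart) →
      Nat.card (Quotient (G.twoSum H f hf e he φ).bpart) = l + Nat.card (Quotient K.bpart) →
      (G.twoSum H f hf e he φ).edgelessValue = W * K.edgelessValue := by
    intro X E G f hf φ K h1 h2 h3
    rw [edgelessValue, h1, h2, h3, edgelessValue, hW]
    ring
  -- If `H` relates its two arrows, the 2-sum unites the classes at `f`, as an operation that unites
  -- them would; if not (`glue2`), the classes at `f` stay as they are.
  have glue1 : ∀ {X : Type _} [Finite X] (r : Setoid X) (x x' : X) (s : Setoid Y)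
      (i : ℕ) (φ : Bool ≃ Bool), s (H.pt e false false) (H.pt e true false) →
      Nat.card (Quotient s) = i + 1 →
      Nat.card (Quotient (((r.disjUnion s).mergeClasses (Sum.inl x)
        (Sum.inr (H.pt e (φ false) false))).mergeClasses (Sum.inl x')
        (Sum.inr (H.pt e (φ true) false)))) = i + Nat.card (Quotient (r.mergeClasses x x')) := by
    intro X _ r x x' s i φ hs hi
    have := Setoid.card_glue_of_rel r s x x'
      ((rel_comp_equiv s (fun i => H.pt e i false) φ).2 hs)
    omega
  have glue2 : ∀ {X : Type _} [Finite X] (r : Setoid X) (x x' : X) (s : Setoid Y)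
      (i : ℕ) (φ : Bool ≃ Bool), ¬ s (H.pt e false false) (H.pt e true false) →
      Nat.card (Quotient s) = i + 2 →
      Nat.card (Quotient (((r.disjUnion s).mergeClasses (Sum.inl x)
        (Sum.inr (H.pt e (φ false) false))).mergeClasses (Sum.inl x')
        (Sum.inr (H.pt e (φ true) false)))) = i + Nat.card (Quotient r) := by
    intro X _ r x x' s i φ hs hi
    have := Setoid.card_glue_of_not_rel r s x x'
      (fun h => hs ((rel_comp_equiv s (fun i => H.pt e i false) φ).1 h))
    omega
  fin_cases k
  -- Pairing `p₁ p₂ | q₁ q₂`: the boundary classes at `f` are united, so `H` acts as deletion, or as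
  -- merge-deletion if its arrows share a vertex class.
  · have hb := hb (by decide)
    rw [if_pos hb] at hl'
    simp only [Fin.zero_eta, Fin.isValue, if_true, if_neg (show (0 : Fin 3) ≠ 1 by decide),
      if_neg (show (0 : Fin 3) ≠ 2 by decide)] at hd hc hp
    have key : ∀ {X : Type _} {E : Type _} [Finite X] (G : PackagedArrowPresentation X E) (f : E)
        (hf : f ∈ G.edges) (φ : Bool ≃ Bool), Nat.card (G.twoSum H f hf e he φ).Vertex =
          n + Nat.card (G.toArrowPresentation.delete f hf).Vertex := by
      intro X E _ G f hf φ
      obtain ⟨k', hk'⟩ := G.exists_pairs hf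
      have h1 := G.card_vertex_twoSum H.toArrowPresentation f hf e he φ hk' hk
      have h2 := G.card_vertex_delete hf hk'
      change Nat.card (G.toArrowPresentation.twoSum _ f hf e he φ).Vertex = _
      simp only [Fin.zero_eta] at h1
      split_ifs at h1 h2 <;> omega
    by_cases hv : H.vpart (H.pt e false false) (H.pt e true false)
    · rw [if_pos hv] at hm'
      refine ⟨3, W, fun j => ?_, fun G f hf φ => hsum G f hf φ _ (key G f hf φ)
        (glue1 _ _ _ _ _ _ hv hm'.symm) (glue1 _ _ _ _ _ _ hb hl'.symm)⟩
      -- The parameters are the excesses over `n`, `m` and `l`. Deletion follows the pairing, so it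
      -- keeps all `n + 2` outer classes as vertices; the other two rejoinings lose one.
      rw [hops (d := 2) (c := 1) (p := 1) (v := 1) (b := 1) (by omega) (by omega) (by omega)
        (by omega) (by omega)]
      congr 1
      fin_cases j <;> simp [systemMatrix] <;> ring
    · rw [if_neg hv] at hm'
      refine ⟨0, W, fun j => ?_, fun G f hf φ => hsum G f hf φ _ (key G f hf φ)
        (glue2 _ _ _ _ _ _ hv hm'.symm) (glue1 _ _ _ _ _ _ hb hl'.symm)⟩
      rw [hops (d := 2) (c := 1) (p := 1) (v := 2) (b := 1) (by omega) (by omega) (by omega)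
        (by omega) (by omega)]
      congr 1
      fin_cases j <;> simp [systemMatrix] <;> ring
  -- Pairing `p₁ q₂ | p₂ q₁`, with the roles of vertex and boundary classes exchanged: contraction,
  -- or merge-contraction if the arrows share a boundary class.
  · have hv := hv (by decide)
    rw [if_pos hv] at hm'
    simp only [Fin.mk_one, Fin.isValue, if_true, if_neg (show (1 : Fin 3) ≠ 0 by decide),
      if_neg (show (1 : Fin 3) ≠ 2 by decide)] at hd hc hp
    have key : ∀ {X : Type _} {E : Type _} [Finite X] (G : PackagedArrowPresentation X E) (f : E)
        (hf : f ∈ G.edges) (φ : Bool ≃ Bool), Nat.card (G.twoSum H f hf e he φ).Vertex =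
          n + Nat.card (G.toArrowPresentation.contract f hf).Vertex := by
      intro X E _ G f hf φ
      obtain ⟨k', hk'⟩ := G.exists_pairs hf
      have h1 := G.card_vertex_twoSum H.toArrowPresentation f hf e he φ hk' hk
      have h2 := G.card_vertex_contract hf hk'
      change Nat.card (G.toArrowPresentation.twoSum _ f hf e he φ).Vertex = _
      simp only [Fin.mk_one] at h1
      split_ifs at h1 h2 <;> omega
    by_cases hb : H.bpart (H.pt e false false) (H.pt e true false)
    · rw [if_pos hb] at hl'
      refine ⟨4, W, fun j => ?_, fun G f hf φ => hsum G f hf φ _ (key G f hf φ)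
        (glue1 _ _ _ _ _ _ hv hm'.symm) (glue1 _ _ _ _ _ _ hb hl'.symm)⟩
      rw [hops (d := 1) (c := 2) (p := 1) (v := 1) (b := 1) (by omega) (by omega) (by omega)
        (by omega) (by omega)]
      congr 1
      fin_cases j <;> simp [systemMatrix] <;> ring
    · rw [if_neg hb] at hl'
      refine ⟨1, W, fun j => ?_, fun G f hf φ => hsum G f hf φ _ (key G f hf φ)
        (glue1 _ _ _ _ _ _ hv hm'.symm) (glue2 _ _ _ _ _ _ hb hl'.symm)⟩
      rw [hops (d := 1) (c := 2) (p := 1) (v := 1) (b := 2) (by omega) (by omega) (by omega)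
        (by omega) (by omega)]
      congr 1
      fin_cases j <;> simp [systemMatrix] <;> ring
  -- Pairing `p₁ q₁ | p₂ q₂`: both relations are forced, which leaves only Penrose-contraction.
  · have hv := hv (by decide)
    have hb := hb (by decide)
    rw [if_pos hv] at hm'
    rw [if_pos hb] at hl'
    simp only [Fin.reduceFinMk, Fin.isValue, if_true, if_neg (show (2 : Fin 3) ≠ 0 by decide),
      if_neg (show (2 : Fin 3) ≠ 1 by decide)] at hd hc hp
    have key : ∀ {X : Type _} {E : Type _} [Finite X] (G : PackagedArrowPresentation X E) (f : E)
        (hf : f ∈ G.edges) (φ : Bool ≃ Bool), Nat.card (G.twoSum H f hf e he φ).Vertex =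
          n + Nat.card (G.toArrowPresentation.penrose f hf).Vertex := by
      intro X E _ G f hf φ
      obtain ⟨k', hk'⟩ := G.exists_pairs hf
      have h1 := G.card_vertex_twoSum H.toArrowPresentation f hf e he φ hk' hk
      have h2 := G.card_vertex_penrose hf hk'
      change Nat.card (G.toArrowPresentation.twoSum _ f hf e he φ).Vertex = _
      simp only [Fin.reduceFinMk] at h1
      split_ifs at h1 h2 <;> omega
    refine ⟨2, W, fun j => ?_, fun G f hf φ => hsum G f hf φ _ (key G f hf φ)
      (glue1 _ _ _ _ _ _ hv hm'.symm) (glue1 _ _ _ _ _ _ hb hl'.symm)⟩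
    rw [hops (d := 1) (c := 1) (p := 2) (v := 1) (b := 1) (by omega) (by omega) (by omega)
      (by omega) (by omega)]
    congr 1
    fin_cases j <;> simp [systemMatrix] <;> ring

/-! ### Induction on the edges of the two summands -/

theorem Q_of_edges_eq_singleton (t : Fin 5) (G : PackagedArrowPresentation X E) {f : E}
    (h : G.edges = {f}) (hf : f ∈ G.edges) : Q (op t G f hf) = (op t G f hf).edgelessValue := by
  classical
  refine isQ_Q.2 _ ?_
  rw [op_edges, h]
  exact Finset.erase_singleton f

theorem exists_edge_ne {G : PackagedArrowPresentation X E} {f : E} (hf : f ∈ G.edges)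
    (h : G.edges ≠ {f}) : ∃ g ∈ G.edges, g ≠ f := by
  by_contra! hall
  exact h (Finset.eq_singleton_iff_unique_mem.2 ⟨hf, hall⟩)

/-- Both sides satisfy the same expansion at any edge `g ≠ f` of `G`, so the identity descends to
presentations whose only edge is `f`, where it is the hypothesis `hw` on edgeless values. -/
theorem Q_twoSum_single_edge {X : Type*} {E : Type*} [Finite X]
    (H : PackagedArrowPresentation Y F) {e : F} (h : H.edges = {e}) (he : e ∈ H.edges)
    (φ : Bool ≃ Bool) {t : Fin 5} {w : QRing}
    (hw : ∀ (G : PackagedArrowPresentation X E) (f : E) (hf : f ∈ G.edges),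
      (G.twoSum H f hf e he φ).edgelessValue = w * (op t G f hf).edgelessValue)
    (n : ℕ) (G : PackagedArrowPresentation X E) (hn : G.edges.card = n) (f : E)
    (hf : f ∈ G.edges) :
    Q (G.twoSum H f hf e he φ) = w * Q (op t G f hf) := by
  classical
  induction n generalizing G with
  | zero => exact absurd hf (by simp [Finset.card_eq_zero.1 hn])
  | succ n ih =>
    by_cases hG : G.edges = {f}
    · rw [Q_of_edges_eq_singleton t G hG, ← hw]
      refine isQ_Q.2 _ ?_
      simp [twoSum, ArrowPresentation.twoSum, hG, h]
    · obtain ⟨g, hg, hne⟩ := exists_edge_ne hf hG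
      have h1 : Sum.inl g ∈ (G.twoSum H f hf e he φ).edges := by
        simp [twoSum, ArrowPresentation.twoSum, hg, hne]
      have h2 : ∀ k, f ∈ (op k G g hg).edges := fun k => by
        rw [op_edges]; exact Finset.mem_erase.2 ⟨hne.symm, hf⟩
      have h3 : g ∈ (op t G f hf).edges := by
        rw [op_edges]; exact Finset.mem_erase.2 ⟨hne, hg⟩
      rw [Q_eq_sum _ _ h1, Q_eq_sum _ _ h3, Finset.mul_sum]
      refine Finset.sum_congr rfl fun k _ => ?_
      rw [op_twoSum_inl k G H f hf e he φ g hg h1 (h2 k), ih _ (card_op_edges k G g hg n hn),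
        op_comm k t G g f hg hf (h2 k) h3, mul_left_comm]

theorem exists_solution {X : Type*} {E : Type*} [Finite X] [Finite Y] (φ : Bool ≃ Bool) (n : ℕ)
    (H : PackagedArrowPresentation Y F) (hn : H.edges.card = n) (e : F) (he : e ∈ H.edges) :
    ∃ ϕ : Fin 5 → QRing, systemMatrix *ᵥ ϕ = H.qVec e he ∧
      ∀ (G : PackagedArrowPresentation X E) (f : E) (hf : f ∈ G.edges),
        Q (G.twoSum H f hf e he φ) = G.qVec f hf ⬝ᵥ ϕ := by
  classical
  induction n generalizing H with
  | zero => exact absurd he (by simp [Finset.card_eq_zero.1 hn])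
  | succ n ih =>
    by_cases hH : H.edges = {e}
    · obtain ⟨t, w, hw, hsum⟩ := H.exists_op_of_single_edge hH he
      -- The right-hand side is `w` times column `t` of the matrix.
      refine ⟨Pi.single t w, ?_, fun G f hf => ?_⟩
      · ext1 j
        rw [qVec_apply, Q_of_edges_eq_singleton j H hH, hw, Matrix.mulVec_single]
        simp [mul_comm]
      · rw [Q_twoSum_single_edge H hH he φ (fun G f hf => hsum G f hf φ) _ G rfl f hf,
          dotProduct_single, qVec_apply, mul_comm]
    · obtain ⟨g, hg, hne⟩ := exists_edge_ne he hH
      have h2 : ∀ k, e ∈ (op k H g hg).edges := fun k => by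
        rw [op_edges]; exact Finset.mem_erase.2 ⟨hne.symm, he⟩
      choose ϕ hϕ hsum using fun k => ih (op k H g hg) (card_op_edges k H g hg n hn) (h2 k)
      -- The right-hand side for `H` is the expansion at `g`, entry by entry, of those for `op k H g
      -- hg`; the solutions combine with the same coefficients.
      refine ⟨∑ k, (MvPolynomial.X (opVar k) : QRing) • ϕ k, ?_, fun G f hf => ?_⟩
      · ext1 j
        have h3 : g ∈ (op j H e he).edges := by
          rw [op_edges]; exact Finset.mem_erase.2 ⟨hne, hg⟩
        rw [qVec_apply, Q_eq_sum _ _ h3, Matrix.mulVec_sum, Finset.sum_apply]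
        refine Finset.sum_congr rfl fun k _ => ?_
        rw [Matrix.mulVec_smul, hϕ, Pi.smul_apply, qVec_apply, smul_eq_mul,
          op_comm k j H g e hg he (h2 k) h3]
      · have h1 : Sum.inr g ∈ (G.twoSum H f hf e he φ).edges := by
          simp [twoSum, ArrowPresentation.twoSum, hg, hne]
        rw [Q_eq_sum _ _ h1, dotProduct_sum]
        refine Finset.sum_congr rfl fun k _ => ?_
        rw [op_twoSum_inr k G H f hf e he φ g hg h1 (h2 k), hsum, dotProduct_smul, smul_eq_mul]

end PackagedArrowPresentation

theorem mainTheorem6 {X Y E F : Type*} [Finite X] [Finite Y]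
    (G : PackagedArrowPresentation X E) (H : PackagedArrowPresentation Y F)
    (f : E) (hf : f ∈ G.edges) (e : F) (he : e ∈ H.edges)
    -- the coupling: the `i`-th arrow of `f` is sent to the `φ i`-th arrow of `e`
    (φ : Bool ≃ Bool) :
    ∃ ϕ : Fin 5 → QRing,
      -- over the field of fractions, `ϕ` is the one and only solution of the system
      (∀ ψ : Fin 5 → FractionRing QRing,
        systemMatrix.map (algebraMap QRing (FractionRing QRing)) *ᵥ ψ =
            algebraMap QRing (FractionRing QRing) ∘ H.qVec e he ↔
          ψ = algebraMap QRing (FractionRing QRing) ∘ ϕ) ∧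
      (G.twoSum H f hf e he φ).Q = G.qVec f hf ⬝ᵥ ϕ := by
  obtain ⟨ϕ, h1, h2⟩ := PackagedArrowPresentation.exists_solution (X := X) (E := E) φ _ H rfl e he
  exact ⟨ϕ, systemMatrix_map_mulVec_eq_iff h1, h2 G f hf⟩
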